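/- **Setting.** Let $p,M\ge 1$ and write $\beta=(\beta_1,\dots,\beta_p)\in\mathbb R^{pM}$ with blocks $\beta_j\in\mathbb R^M$; $z_{-1}$ denotes $z\in\mathbb R^M$ without its first coordinate. Let $L:\mathbb R^{pM}\to\mathbb R$ be convex and differentiable, and suppose that for each $j$ the block gradient $\nabla_jL$ is Lipschitz in block $j$ with constant $C_j>0$ (uniformly in the other blocks). Let $\lambda\ge0$, $\alpha\in[0,1]$, $h(\beta)=\lambda\sum_{j}[\alpha\|\beta_j\|_2+(1-\alpha)\|\beta_{j,-1}\|_2]$ and $F=L+h$. **Algorithm.** Start from any $\beta^0$ (for instance $\beta^0=0$) and step sizes $t_j=t_j^0>0$, and fix $\eta\in(0,1)$. Visit the blocks $j=1,\dots,p$ cyclically. At the current point $\beta$, with $g=\beta_j-t_j\nabla_jL(\beta)$, compute $\gamma_2=\Pi_{t_j\lambda(1-\alpha)}(g_{-1})$, $\gamma_1=\Pi_{t_j\lambda\alpha}(g-[0,\gamma_2])$ and $z=g-\gamma_1-[0,\gamma_2]$, where $\Pi_r$ is the projection onto the ball of radius $r$ about $0$. Let $\tilde\beta$ be $\beta$ with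 block $j$ replaced by $z$. If $$L(\tilde\beta)\le L(\beta)+\langle z-\beta_j,\nabla_jL(\beta)\rangle+\tfrac1{2t_j}\|z-\beta_j\|_2^2,\qquad(*)$$ replace $\beta$ by $\tilde\beta$ and go on to the next block, keeping the current $t_j$; otherwise replace $t_j$ by $\max(\eta t_j,1/C_j)$ and repeat. The same is also claimed, except where stated, for the variant with $\min(\eta t_j,1/C_j)$. Let $x^n$ be the point after $n$ block updates, $j_n$ the block updated in passing from $x^n$ to $x^{n+1}$, $t_n$ the step size accepted there, and $\beta^k=x^{kp}$ the point after $k$ cycles. **Framework.** A coordinate gradient descent run for $L+h$ with $0<\sigma<1$, $0\le\gamma<1$, $0<\underline\theta\le\overline\theta$ is a sequence $x^{n+1}=x^n+a^nd^n$, $a^n>0$, where $H^n$ is symmetric, $\underline\theta I\preceq H^n\preceq\overline\theta I$, $d^n$ minimizes $\nabla L(x^n)^Td+\frac12d^TH^nd+h(x^n+d)$ over the $d$ supported on the chosen block $j_n$, and the Armijo rule $F(x^n+a^nd^n)\le F(x^n)+a^n\sigma\Delta^n$ holds with $\Delta^n=\nabla L(x^n)^Td^n+\gamma (d^n)^TH^nd^n+h(x^n+d^n)-h(x^n)$.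 **Theorem.** 1. Every backtracking loop stops after finitely many trials, with a step size satisfying $(*)$. 2. For every $\beta$, $j$ and $t>0$, the trial step $\tilde\beta-\beta$ with $t_j=t$ is the framework's direction for $H=I/t$, and $(*)$ is equivalent to the Armijo rule with $a=1$, $\sigma=1$, $\gamma=\frac12$. 3. $\min\{C_{j_n},1/t^0_{j_n}\}\le 1/t_n\le\max\{C_{j_n},1/t^0_{j_n}\}$ for all $n$ (for the $\min$ variant the upper bound is $\max\{C_{j_n}/\eta,1/t^0_{j_n}\}$). There are $0<\underline\theta\le\overline\theta$ such that, for every $\sigma\in(0,1)$, $(x^n)$ is a run of the framework with cyclic blocks, $H^n=I/t_n$, $a^n=1$ and $\gamma=\frac12$. 4. (Global convergence.) Every cluster point of $(x^n)$ is a global minimizer of $F$. If $\{F\le F(\beta^0)\}$ is bounded, then $F$ has a minimizer and $F(x^n)\to\min F$. 5. (Linear convergence.) There are a minimizer $\beta^*$ of $F$, some $q,q'\in[0,1)$ and some $c$ such that $F(\beta^{k})\to F(\beta^*)$, $F(\beta^{k+1})-F(\beta^*)\le q\,(F(\beta^k)-F(\beta^*))$ for all large $k$ (Q-linear convergence), and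 $\|\beta^k-\beta^*\|\le c\,q'^k$ for all $k$ (R-linear convergence), in each of the following cases, where $N\ge1$ and $X\in\mathbb R^{N\times pM}$: (a) $L(\beta)=\frac1{2N}\|y-X\beta\|_2^2$ with $y\in\mathbb R^N$; (b) $L(\beta)=\frac1N\sum_i\log(1+\exp[-y_i(X\beta)_i])$ with $y_i\in\{-1,1\}$, and $F$ has a minimizer; (c) $F$ has a minimizer, and the local error bound holds: for every $\zeta$ there are $\tau,\varepsilon>0$ such that $\mathrm{dist}(\beta,\arg\min F)\le\tau\|r(\beta)\|$ whenever $F(\beta)\le\zeta$ and $\|r(\beta)\|\le\varepsilon$, where $r(\beta)$ is the minimizer of $\nabla L(\beta)^Tr+\frac12\|r\|^2+h(\beta+r)$. -/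

import Mathlib

open Filter Topology

noncomputable section

/-- Coefficient vectors `β = (β_1, …, β_p)` made of `p` blocks `β_j ∈ ℝ^M`, with the Euclidean
norm of `ℝ^{pM}`. -/
abbrev Coef (p M : ℕ) : Type := PiLp 2 (fun _ : Fin p => EuclideanSpace ℝ (Fin M))

/-- `β` with its `j`-th block replaced by `z`. -/
def setBlock {p M : ℕ} (β : Coef p M) (j : Fin p) (z : EuclideanSpace ℝ (Fin M)) : Coef p M :=
  WithLp.toLp 2 (Function.update (fun i => β i) j z)

/-- The `j`-th block `∇_j L(β)` of the gradient of `L`. -/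
def blockGrad {p M : ℕ} (L : Coef p M → ℝ) (β : Coef p M) (j : Fin p) :
    EuclideanSpace ℝ (Fin M) :=
  gradient L β j

/-- The nonlinear part `z_{-1} = (z_2, …, z_M)` of a block, as the vector `[0, z_{-1}]` of `ℝ^M`
(index `0` is the linear coefficient), so that its norm is `‖z_{-1}‖₂`. -/
def nonlin {M : ℕ} [NeZero M] (z : EuclideanSpace ℝ (Fin M)) : EuclideanSpace ℝ (Fin M) :=
  WithLp.toLp 2 (Function.update (fun i => z i) 0 0)

/-- The penalty `Ω(β) = ∑_j [α ‖β_j‖₂ + (1 - α) ‖β_{j,-1}‖₂]`. -/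
def splamPenalty {p M : ℕ} [NeZero M] (α : ℝ) (β : Coef p M) : ℝ :=
  ∑ j, (α * ‖β j‖ + (1 - α) * ‖nonlin (β j)‖)

/-- The SPLAM objective `F = L + lam • Ω`. -/
def splamObj {p M : ℕ} [NeZero M] (L : Coef p M → ℝ) (lam α : ℝ) (β : Coef p M) : ℝ :=
  L β + lam * splamPenalty α β

/-- The linear predictor `(X β)_i = ∑_j ∑_m X_{i,(j,m)} β_{jm}`. -/
def linPred {N p M : ℕ} (X : Matrix (Fin N) (Fin p × Fin M) ℝ) (β : Coef p M) (i : Fin N) : ℝ :=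
  ∑ j, ∑ m, X i (j, m) * β j m

/-- The quadratic loss `(1 / 2N) ‖y - X β‖²`. -/
def quadLoss {N p M : ℕ} (X : Matrix (Fin N) (Fin p × Fin M) ℝ) (y : Fin N → ℝ)
    (β : Coef p M) : ℝ :=
  1 / (2 * (N : ℝ)) * ∑ i, (y i - linPred X β i) ^ 2

/-- The logistic loss `(1 / N) ∑_i log (1 + exp (- y_i (X β)_i))`. -/
def logisticLoss {N p M : ℕ} (X : Matrix (Fin N) (Fin p × Fin M) ℝ) (y : Fin N → ℝ)
    (β : Coef p M) : ℝ :=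
  1 / (N : ℝ) * ∑ i, Real.log (1 + Real.exp (-(y i * linPred X β i)))

/-! ### The algorithm -/

/-- Projection `Π_r(u)` of `u` onto the closed ball of radius `r` about the origin. -/
def projBall {M : ℕ} (r : ℝ) (u : EuclideanSpace ℝ (Fin M)) : EuclideanSpace ℝ (Fin M) :=
  if ‖u‖ ≤ r then u else (r / ‖u‖) • u

/-- One pass of block coordinate descent on the dual of the block subproblem: the primal point
`g - γ₁ - [0, γ₂]` with `γ₂ = Π_{t lam (1-α)}(g_{-1})`, `γ₁ = Π_{t lam α}(g - [0, γ₂])`. -/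
def dualPass {M : ℕ} [NeZero M] (lam α t : ℝ) (g : EuclideanSpace ℝ (Fin M)) :
    EuclideanSpace ℝ (Fin M) :=
  let γ₂ := projBall (t * lam * (1 - α)) (nonlin g)
  let γ₁ := projBall (t * lam * α) (g - γ₂)
  g - γ₁ - γ₂

/-- The trial value of block `j` with step size `t` at the current point `β`. -/
def trialBlock {p M : ℕ} [NeZero M] (L : Coef p M → ℝ) (lam α : ℝ) (β : Coef p M) (j : Fin p)
    (t : ℝ) : EuclideanSpace ℝ (Fin M) :=
  dualPass lam α t (β j - t • blockGrad L β j)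

/-- The backtracking inequality, for the trial value of block `j` with step size `t`. -/
def Accepts {p M : ℕ} [NeZero M] (L : Coef p M → ℝ) (lam α : ℝ) (β : Coef p M) (j : Fin p)
    (t : ℝ) : Prop :=
  L (setBlock β j (trialBlock L lam α β j t)) ≤
    L β + inner ℝ (trialBlock L lam α β j t - β j) (blockGrad L β j)
      + 1 / (2 * t) * ‖trialBlock L lam α β j t - β j‖ ^ 2

/-- The step size after `m` rejections, starting from `t`; each rejection replaces the step size
`s` by `shrink (η s) (1 / c)`. -/
def backtrackStep (shrink : ℝ → ℝ → ℝ) (η c t : ℝ) (m : ℕ) : ℝ :=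
  (fun s => shrink (η * s) (1 / c))^[m] t

/-- The step size with which the inner loop stops: the first one that is accepted. -/
def acceptedStep {p M : ℕ} [NeZero M] (L : Coef p M → ℝ) (lam α : ℝ) (shrink : ℝ → ℝ → ℝ)
    (η : ℝ) (C : Fin p → ℝ) (β : Coef p M) (j : Fin p) (t : ℝ) : ℝ :=
  backtrackStep shrink η (C j) t
    (sInf {m : ℕ | Accepts L lam α β j (backtrackStep shrink η (C j) t m)})

/-- The block treated in the `n`-th block update: blocks are visited cyclically. -/
def cyclicBlock (p : ℕ) [NeZero p] (n : ℕ) : Fin p := Fin.ofNat p n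

/-- The state (coefficients, current step sizes) of the algorithm after `n` block updates. -/
def bcgdState {p M : ℕ} [NeZero p] [NeZero M] (L : Coef p M → ℝ) (lam α : ℝ)
    (shrink : ℝ → ℝ → ℝ) (η : ℝ) (C t0 : Fin p → ℝ) (β0 : Coef p M) :
    ℕ → Coef p M × (Fin p → ℝ)
  | 0 => (β0, t0)
  | n + 1 =>
    let s := bcgdState L lam α shrink η C t0 β0 n
    let j := cyclicBlock p n
    let t := acceptedStep L lam α shrink η C s.1 j (s.2 j)
    (setBlock s.1 j (trialBlock L lam α s.1 j t), Function.update s.2 j t)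

/-! ### The block coordinate gradient descent framework -/

/-- `d` is a coordinate gradient direction at `β` for block `j` and matrix `H`: it minimizes
`∇L(β)ᵀ d + ½ dᵀ H d + h(β + d)` over the `d` that vanish outside block `j`. -/
def IsCGDDirection {p M : ℕ} (L h : Coef p M → ℝ) (β : Coef p M) (j : Fin p)
    (H : Coef p M →L[ℝ] Coef p M) (d : Coef p M) : Prop :=
  (∀ i, i ≠ j → d i = 0) ∧
    IsMinOn (fun e : Coef p M => inner ℝ (gradient L β) e + 1 / 2 * inner ℝ e (H e) + h (β + e))
      {e | ∀ i, i ≠ j → e i = 0} d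

/-- `Δ = ∇L(β)ᵀ d + γ dᵀ H d + h(β + d) - h(β)`. -/
def cgdDelta {p M : ℕ} (L h : Coef p M → ℝ) (γ : ℝ) (β : Coef p M)
    (H : Coef p M →L[ℝ] Coef p M) (d : Coef p M) : ℝ :=
  inner ℝ (gradient L β) d + γ * inner ℝ d (H d) + h (β + d) - h β

/-- The Armijo rule `F(β + a d) ≤ F(β) + a σ Δ`, where `F = L + h`. -/
def Armijo {p M : ℕ} (L h : Coef p M → ℝ) (σ γ : ℝ) (β : Coef p M)
    (H : Coef p M →L[ℝ] Coef p M) (d : Coef p M) (a : ℝ) : Prop :=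
  L (β + a • d) + h (β + a • d) ≤ L β + h β + a * σ * cgdDelta L h γ β H d

/-- `x` is a run of the block coordinate gradient descent framework for `L + h`, with blocks `J n`,
symmetric matrices `θlo I ⪯ H n ⪯ θhi I`, directions `d n` and Armijo step sizes `a n`. -/
structure IsCGDRun {p M : ℕ} (L h : Coef p M → ℝ) (σ γ θlo θhi : ℝ) (J : ℕ → Fin p)
    (H : ℕ → Coef p M →L[ℝ] Coef p M) (d : ℕ → Coef p M) (a : ℕ → ℝ) (x : ℕ → Coef p M) :
    Prop where
  sigma_pos : 0 < σ
  sigma_lt_one : σ < 1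
  gamma_nonneg : 0 ≤ γ
  gamma_lt_one : γ < 1
  theta_pos : 0 < θlo
  theta_le : θlo ≤ θhi
  symmetric : ∀ n u v, inner ℝ (H n u) v = inner ℝ u (H n v)
  lower : ∀ n v, θlo * ‖v‖ ^ 2 ≤ inner ℝ v (H n v)
  upper : ∀ n v, inner ℝ v (H n v) ≤ θhi * ‖v‖ ^ 2
  direction : ∀ n, IsCGDDirection L h (x n) (J n) (H n) (d n)
  step_pos : ∀ n, 0 < a n
  armijo : ∀ n, Armijo L h σ γ (x n) (H n) (d n) (a n)
  update : ∀ n, x (n + 1) = x n + a n • d n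

/-! ### Convergence notions -/

/-- The set of global minimizers of `F`. -/
def minimizers {E : Type*} (F : E → ℝ) : Set E := {x | ∀ z, F x ≤ F z}

/-- Q-linear convergence of a real sequence `u` to `l`. -/
def QLinear (u : ℕ → ℝ) (l : ℝ) : Prop :=
  Tendsto u atTop (𝓝 l) ∧
    ∃ q : ℝ, 0 ≤ q ∧ q < 1 ∧ ∀ᶠ k in atTop, |u (k + 1) - l| ≤ q * |u k - l|

/-- R-linear convergence of a sequence `x` to `l`. -/
def RLinear {E : Type*} [NormedAddCommGroup E] (x : ℕ → E) (l : E) : Prop :=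
  ∃ c q : ℝ, 0 ≤ q ∧ q < 1 ∧ ∀ k, ‖x k - l‖ ≤ c * q ^ k

/-- The local Lipschitzian error bound for `F = L + h`: on each sublevel set, the distance to the
minimizers is bounded by a multiple of the residual `r`, the minimizer of
`∇L(β)ᵀ r + ½ ‖r‖² + h(β + r)`, as soon as the residual is small. -/
def LocalErrorBound {p M : ℕ} (L h : Coef p M → ℝ) : Prop :=
  ∀ ζ : ℝ, ∃ τ ε : ℝ, 0 < τ ∧ 0 < ε ∧ ∀ β r : Coef p M,
    L β + h β ≤ ζ →
    IsMinOn (fun e : Coef p M => inner ℝ (gradient L β) e + 1 / 2 * ‖e‖ ^ 2 + h (β + e))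
      Set.univ r →
    ‖r‖ ≤ ε →
    Metric.infDist β (minimizers fun β' => L β' + h β') ≤ τ * ‖r‖

/-- Linear convergence of the algorithm: for some minimizer `βs` of `F`, the objective values
`F(β^k)` converge Q-linearly to `F(βs)`, and the iterates `β^k` converge R-linearly to `βs`. -/
def ConvergesLinearly {p M : ℕ} (F : Coef p M → ℝ) (β : ℕ → Coef p M) : Prop :=
  ∃ βs ∈ minimizers F, QLinear (fun k => F (β k)) (F βs) ∧ RLinear β βs

end

/-! One pass of dual projections is the exact proximal step on a block because the two norms are
nested: shrinking the whole block only rescales its nonlinear part. The trial value is thus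
characterised by a subgradient condition (`dualPass_isBlockSubgrad`, `trialBlock_isBlockSubgrad`).
That condition gives the framework's direction for `H = I / t` and, together with the backtracking
inequality, a decrease of the objective by at least `‖step‖² / (2t)` (`Accepts.descent`). The
blockwise descent lemma makes every `t ≤ 1 / C j` acceptable, so the inner loops stop and the step
sizes stay between positive bounds.

Convexity upgrades the block Lipschitz constants to a global one for the gradient of `L`. The
optimality conditions of the blocks, each taken at its last update in a cycle, then assemble into a
subgradient of the objective at the end of the cycle whose squared norm is at most a constant times
the decrease over the cycle (`IsProxRun.exists_subgradient`). If there is a cluster point, the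
objective values converge, these subgradients vanish, and the cluster point is a minimizer.

For the linear rate, suppose that small subgradients `v` bound the optimality gap by `A ‖v‖²`. The
gap after a cycle is then at most a multiple of the decrease over that cycle, hence it contracts,
and the increments are geometrically small (`IsProxRun.convergesLinearly`). Under the local error
bound, the gap is at most `‖v‖` times the distance to the minimizers, and this distance is at most
`τ ‖r‖ ≤ τ ‖v‖`. For the quadratic and logistic losses, the objective grows quadratically away from
its minimizers (`exists_quadratic_growth`). There the gap is a sum of Bregman divergences of the
losses and of the norms, each of which controls the square of the residual of a linear equation or
inequality; Hoffman's bound turns these residuals into the distance to a polyhedron of minimizers.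
-/

noncomputable section

/-! ### Replacing one block: algebra, inner products and norms. -/

section Blocks
variable {p M : ℕ}

@[simp] theorem setBlock_apply_self (β : Coef p M) (j : Fin p) (z : EuclideanSpace ℝ (Fin M)) :
    setBlock β j z j = z := by
  simp [setBlock]

theorem setBlock_apply_of_ne (β : Coef p M) {i j : Fin p} (z : EuclideanSpace ℝ (Fin M))
    (hij : i ≠ j) : setBlock β j z i = β i := by
  simp [setBlock, hij]

@[simp] theorem setBlock_eta (β : Coef p M) (j : Fin p) : setBlock β j (β j) = β := by
  simp [setBlock]

theorem setBlock_sub_apply_of_ne (β : Coef p M) {i j : Fin p} (z : EuclideanSpace ℝ (Fin M))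
    (hij : i ≠ j) : (setBlock β j z - β) i = 0 := by
  simp [setBlock_apply_of_ne β z hij]

theorem eq_setBlock_of_supported {β e : Coef p M} {j : Fin p} (he : ∀ i, i ≠ j → e i = 0) :
    β + e = setBlock β j (β j + e j) := by
  ext1 i
  by_cases hij : i = j
  · subst hij; simp
  · simp [setBlock_apply_of_ne β _ hij, he i hij]

theorem inner_of_supported {v e : Coef p M} {j : Fin p} (he : ∀ i, i ≠ j → e i = 0) :
    inner ℝ v e = inner ℝ (v j) (e j) := by
  rw [PiLp.inner_apply, Finset.sum_eq_single j]
  · intro i _ hij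
    simp [he i hij]
  · simp

theorem inner_setBlock_sub (v β : Coef p M) (j : Fin p) (z : EuclideanSpace ℝ (Fin M)) :
    inner ℝ v (setBlock β j z - β) = inner ℝ (v j) (z - β j) := by
  rw [inner_of_supported (fun i => setBlock_sub_apply_of_ne β z)]
  simp

theorem norm_setBlock_sub (β : Coef p M) (j : Fin p) (z : EuclideanSpace ℝ (Fin M)) :
    ‖setBlock β j z - β‖ = ‖z - β j‖ := by
  have h := inner_setBlock_sub (setBlock β j z - β) β j z
  rw [real_inner_self_eq_norm_sq] at h
  simp only [PiLp.sub_apply, setBlock_apply_self, real_inner_self_eq_norm_sq] at h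
  exact (sq_eq_sq₀ (norm_nonneg _) (norm_nonneg _)).1 h

theorem setBlock_smul_segment (β : Coef p M) (j : Fin p) (z : EuclideanSpace ℝ (Fin M)) (s : ℝ) :
    setBlock β j (β j + s • (z - β j)) = β + s • (setBlock β j z - β) := by
  rw [eq_setBlock_of_supported (j := j) (e := s • (setBlock β j z - β))]
  · simp
  · intro i hij
    rw [PiLp.smul_apply, setBlock_sub_apply_of_ne β z hij, smul_zero]

theorem sum_setBlock_sub (x d : Coef p M) (c : ℝ) :
    ∑ j, (setBlock x j (x j + c • d j) - x) = c • d := by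
  ext1 i
  rw [WithLp.ofLp_sum, Finset.sum_apply, Finset.sum_eq_single i]
  · simp
  · intro j _ hji
    exact setBlock_sub_apply_of_ne x _ hji.symm
  · simp

end Blocks

/-! ### Convex differentiable functions: tangent inequality and Lipschitz gradient. -/

section Convex
variable {E : Type*} [NormedAddCommGroup E] [InnerProductSpace ℝ E] [CompleteSpace E]

theorem hasDerivAt_line {L : E → ℝ} (hL : Differentiable ℝ L) (x d : E) (s : ℝ) :
    HasDerivAt (fun s : ℝ => L (x + s • d)) (inner ℝ (gradient L (x + s • d)) d) s := by
  have h1 := (hL (x + s • d)).hasGradientAt.hasFDerivAt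
  have h2 : HasDerivAt (fun s : ℝ => x + s • d) d s := by
    simpa using ((hasDerivAt_id s).smul_const d).const_add x
  exact (h1.comp_hasDerivAt s h2).congr_deriv (by simp)

theorem ConvexOn.add_inner_gradient_le {L : E → ℝ} (hc : ConvexOn ℝ Set.univ L)
    (hL : Differentiable ℝ L) (x y : E) :
    L x + inner ℝ (gradient L x) (y - x) ≤ L y := by
  have hg : ConvexOn ℝ Set.univ (fun s : ℝ => L (x + s • (y - x))) := by
    have := hc.comp_affineMap (AffineMap.lineMap x y : ℝ →ᵃ[ℝ] E)
    simpa [Function.comp_def, AffineMap.lineMap_apply, add_comm] using this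
  have hd := hasDerivAt_line hL x (y - x) 0
  have := hg.le_slope_of_hasDerivAt (Set.mem_univ 0) (Set.mem_univ 1) one_pos hd
  simp only [slope_def_field, zero_smul, add_zero, one_smul, add_sub_cancel, sub_zero,
    div_one] at this
  linarith

/-- A convex function with a quadratic upper bound has a Lipschitz gradient. -/
theorem ConvexOn.norm_gradient_sub_le {L : E → ℝ} (hc : ConvexOn ℝ Set.univ L)
    (hL : Differentiable ℝ L) {Λ : ℝ} (hΛ : 0 < Λ)
    (hub : ∀ x d, L (x + d) ≤ L x + inner ℝ (gradient L x) d + Λ / 2 * ‖d‖ ^ 2) (x y : E) :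
    ‖gradient L y - gradient L x‖ ≤ Λ * ‖y - x‖ := by
  set w := gradient L y - gradient L x with hw
  -- The value at `y - w / Λ` is bounded above by the quadratic model at `y` and below by the
  -- tangent at `x`. With the quadratic model at `x` evaluated at `y`, this yields `‖w‖² / (2Λ) ≤ (Λ
  -- / 2) ‖y - x‖²`.
  have h1 := hub y (-(1 / Λ) • w)
  have h2 := hc.add_inner_gradient_le hL x (y + -(1 / Λ) • w)
  have h3 := hub x (y - x)
  have e1 : inner ℝ (gradient L x) (y + -(1 / Λ) • w - x) =
      inner ℝ (gradient L x) (y - x) - 1 / Λ * inner ℝ (gradient L x) w := by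
    rw [show y + -(1 / Λ) • w - x = (y - x) + -(1 / Λ) • w by abel, inner_add_right,
      inner_smul_right]
    ring
  have e2 : inner ℝ (gradient L y) w - inner ℝ (gradient L x) w = ‖w‖ ^ 2 := by
    rw [← inner_sub_left, ← hw, real_inner_self_eq_norm_sq]
  rw [inner_smul_right, norm_smul, mul_pow, norm_neg, Real.norm_of_nonneg (by positivity)] at h1
  rw [e1] at h2
  rw [add_sub_cancel] at h3
  have e3 : Λ / 2 * ((1 / Λ) ^ 2 * ‖w‖ ^ 2) = 1 / Λ * ‖w‖ ^ 2 / 2 := by field_simp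
  rw [e3] at h1
  have h4 : 1 / Λ * ‖w‖ ^ 2 / 2 ≤ Λ / 2 * ‖y - x‖ ^ 2 := by
    have : 1 / Λ * ‖w‖ ^ 2 =
      1 / Λ * inner ℝ (gradient L y) w - 1 / Λ * inner ℝ (gradient L x) w := by
      rw [← e2]; ring
    linarith
  have h5 : ‖w‖ ^ 2 ≤ (Λ * ‖y - x‖) ^ 2 := by
    have := mul_le_mul_of_nonneg_left h4 (by positivity : 0 ≤ 2 * Λ)
    have e : 2 * Λ * (1 / Λ * ‖w‖ ^ 2 / 2) = ‖w‖ ^ 2 := by field_simp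
    rw [e] at this
    linarith
  exact (sq_le_sq₀ (norm_nonneg _) (by positivity)).1 h5

end Convex

/-! ### From block Lipschitz gradients to a globally Lipschitz gradient. -/

section Smooth
variable {p M : ℕ} {L : Coef p M → ℝ} {C : Fin p → ℝ}

/-- `∇_j L` is Lipschitz in block `j` with constant `C j`, uniformly in the other blocks. -/
def BlockLipschitz (L : Coef p M → ℝ) (C : Fin p → ℝ) : Prop :=
  ∀ (j : Fin p) (β : Coef p M) (z z' : EuclideanSpace ℝ (Fin M)),
    ‖blockGrad L (setBlock β j z) j - blockGrad L (setBlock β j z') j‖ ≤ C j * ‖z - z'‖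

/-- Along the segment that moves block `j` to `z`, the difference between `L` and its quadratic
model has nonpositive derivative, since the block gradient varies by at most `C j * s * ‖z - β j‖`.
-/
theorem BlockLipschitz.descent (hC : BlockLipschitz L C) (hL : Differentiable ℝ L)
    (β : Coef p M) (j : Fin p) (z : EuclideanSpace ℝ (Fin M)) :
    L (setBlock β j z) ≤ L β + inner ℝ (z - β j) (blockGrad L β j)
      + C j / 2 * ‖z - β j‖ ^ 2 := by
  set d := setBlock β j z - β with hd
  set f : ℝ → ℝ := fun s => L (β + s • d) - s * inner ℝ (z - β j) (blockGrad L β j)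
      - C j / 2 * ‖z - β j‖ ^ 2 * s ^ 2 with hf
  have hder : ∀ s, HasDerivAt f (inner ℝ (gradient L (β + s • d)) d
      - inner ℝ (z - β j) (blockGrad L β j) - C j * ‖z - β j‖ ^ 2 * s) s := by
    intro s
    have h1 := hasDerivAt_line hL β d s
    have h2 := (hasDerivAt_id s).mul_const (inner ℝ (z - β j) (blockGrad L β j))
    have h3 := ((hasDerivAt_id s).pow 2).const_mul (C j / 2 * ‖z - β j‖ ^ 2)
    refine ((h1.sub h2).sub h3).congr_deriv ?_
    simp
    ring
  have hanti : AntitoneOn f (Set.Icc 0 1) := by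
    apply antitoneOn_of_deriv_nonpos (convex_Icc 0 1)
    · exact fun s _ => (hder s).continuousAt.continuousWithinAt
    · exact fun s _ => (hder s).differentiableAt.differentiableWithinAt
    · intro s hs
      rw [interior_Icc] at hs
      rw [(hder s).deriv, hd, inner_setBlock_sub, ← hd, real_inner_comm (blockGrad L β j)]
      have h4 : inner ℝ (gradient L (β + s • d) j) (z - β j)
          - inner ℝ (blockGrad L β j) (z - β j) ≤ C j * ‖z - β j‖ ^ 2 * s := by
        rw [← inner_sub_left]
        refine (real_inner_le_norm _ _).trans ?_
        have h5 := hC j β (β j + s • (z - β j)) (β j)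
        rw [setBlock_smul_segment, setBlock_eta, add_sub_cancel_left, norm_smul,
          Real.norm_of_nonneg hs.1.le] at h5
        calc _ ≤ C j * (s * ‖z - β j‖) * ‖z - β j‖ :=
              mul_le_mul_of_nonneg_right h5 (norm_nonneg _)
          _ = _ := by ring
      linarith
  have := hanti (Set.left_mem_Icc.2 zero_le_one) (Set.right_mem_Icc.2 zero_le_one) zero_le_one
  simp only [hf, hd, one_smul, zero_smul, add_zero, add_sub_cancel] at this
  linarith

/-- The point `x + d` is the average of the `p` points obtained from `x` by moving a single block by
`p • d j`, so Jensen's inequality combines the block estimates. Squaring the factor `p` and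
averaging leaves one factor `p` in the constant. -/
theorem BlockLipschitz.quadratic_upper [NeZero p] (hC : BlockLipschitz L C)
    (hc : ConvexOn ℝ Set.univ L) (hL : Differentiable ℝ L) (hCpos : ∀ j, 0 < C j)
    (x d : Coef p M) :
    L (x + d) ≤ L x + inner ℝ (gradient L x) d + (p * ∑ j, C j) / 2 * ‖d‖ ^ 2 := by
  have hp : (0 : ℝ) < p := by exact_mod_cast Nat.pos_of_ne_zero (NeZero.ne p)
  have hj := hc.map_sum_le (t := Finset.univ) (w := fun _ : Fin p => 1 / (p : ℝ))
    (p := fun j => setBlock x j (x j + (p : ℝ) • d j)) (fun _ _ => by positivity)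
    (by simp [hp.ne']) (fun _ _ => Set.mem_univ _)
  have e : ∑ j, (1 / (p : ℝ)) • setBlock x j (x j + (p : ℝ) • d j) = x + d := by
    have h1 := sum_setBlock_sub x d p
    rw [Finset.sum_sub_distrib] at h1
    simp only [Finset.sum_const, Finset.card_univ, Fintype.card_fin] at h1
    rw [← Finset.smul_sum, sub_eq_iff_eq_add.1 h1, ← Nat.cast_smul_eq_nsmul ℝ, ← smul_add,
      smul_smul]
    simp [hp.ne', add_comm]
  rw [e] at hj
  refine hj.trans ?_
  have h2 : ∀ j : Fin p, (1 / (p : ℝ)) • L (setBlock x j (x j + (p : ℝ) • d j)) ≤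
      1 / p * L x + inner ℝ (gradient L x j) (d j) + p * C j / 2 * ‖d j‖ ^ 2 := by
    intro j
    have := hC.descent hL x j (x j + (p : ℝ) • d j)
    rw [add_sub_cancel_left, inner_smul_left, norm_smul, mul_pow, Real.norm_of_nonneg hp.le,
      real_inner_comm] at this
    rw [smul_eq_mul]
    refine (mul_le_mul_of_nonneg_left this (by positivity)).trans_eq ?_
    simp only [blockGrad, conj_trivial]
    field_simp
  refine (Finset.sum_le_sum fun j _ => h2 j).trans ?_
  rw [Finset.sum_add_distrib, Finset.sum_add_distrib, PiLp.inner_apply]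
  simp only [Finset.sum_const, Finset.card_univ, Fintype.card_fin, nsmul_eq_mul]
  have h3 : ∑ j, p * C j / 2 * ‖d j‖ ^ 2 ≤ (p * ∑ j, C j) / 2 * ‖d‖ ^ 2 := by
    rw [PiLp.norm_sq_eq_of_L2, Finset.mul_sum]
    refine Finset.sum_le_sum fun j _ => mul_le_mul_of_nonneg_right ?_ (by positivity)
    have := Finset.single_le_sum (f := C) (fun i _ => (hCpos i).le) (Finset.mem_univ j)
    have := mul_le_mul_of_nonneg_left this hp.le
    linarith
  have h4 : (p : ℝ) * (1 / p * L x) = L x := by field_simp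
  rw [h4]
  linarith

theorem BlockLipschitz.norm_gradient_sub_le [NeZero p] (hC : BlockLipschitz L C)
    (hc : ConvexOn ℝ Set.univ L) (hL : Differentiable ℝ L) (hCpos : ∀ j, 0 < C j)
    (x y : Coef p M) :
    ‖gradient L y - gradient L x‖ ≤ (p * ∑ j, C j) * ‖y - x‖ := by
  refine hc.norm_gradient_sub_le hL ?_ (hC.quadratic_upper hc hL hCpos) x y
  have hp : (0 : ℝ) < p := by exact_mod_cast Nat.pos_of_ne_zero (NeZero.ne p)
  have : 0 < ∑ j, C j := Finset.sum_pos (fun j _ => hCpos j) Finset.univ_nonempty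
  positivity

end Smooth

/-! ### The projection onto the nonlinear coordinates of a block. -/

section Nonlin
variable {M : ℕ} [NeZero M]

theorem nonlin_apply (z : EuclideanSpace ℝ (Fin M)) (i : Fin M) :
    nonlin z i = if i = 0 then 0 else z i := by
  by_cases h : i = 0
  · subst h; simp [nonlin]
  · simp [nonlin, h]

/-- `nonlin` as a linear map. -/
def nonlinLin : EuclideanSpace ℝ (Fin M) →ₗ[ℝ] EuclideanSpace ℝ (Fin M) where
  toFun := nonlin
  map_add' u v := by
    ext i
    simp only [nonlin_apply, PiLp.add_apply]
    split_ifs <;> simp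
  map_smul' c u := by
    ext i
    simp only [nonlin_apply, PiLp.smul_apply, RingHom.id_apply]
    split_ifs <;> simp

theorem nonlin_sub (u v : EuclideanSpace ℝ (Fin M)) : nonlin (u - v) = nonlin u - nonlin v :=
  nonlinLin.map_sub u v

theorem nonlin_smul (c : ℝ) (u : EuclideanSpace ℝ (Fin M)) : nonlin (c • u) = c • nonlin u :=
  nonlinLin.map_smul c u

@[simp] theorem nonlin_nonlin (z : EuclideanSpace ℝ (Fin M)) : nonlin (nonlin z) = nonlin z := by
  ext i
  simp only [nonlin_apply]
  split_ifs <;> rfl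

theorem inner_nonlin_right (u v : EuclideanSpace ℝ (Fin M)) :
    inner ℝ u (nonlin v) = inner ℝ (nonlin u) v := by
  simp only [PiLp.inner_apply, nonlin_apply]
  refine Finset.sum_congr rfl fun i _ => ?_
  split_ifs <;> simp

end Nonlin

/-! ### One dual pass solves the block subproblem exactly. -/

section DualPass
variable {M : ℕ}

theorem norm_projBall_le {r : ℝ} (hr : 0 ≤ r) (u : EuclideanSpace ℝ (Fin M)) :
    ‖projBall r u‖ ≤ r := by
  unfold projBall
  split_ifs with h
  · exact h
  · have hu : 0 < ‖u‖ := hr.trans_lt (not_le.1 h)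
    rw [norm_smul, Real.norm_of_nonneg (by positivity), div_mul_cancel₀ _ hu.ne']

/-- The coefficient `(1 - r / ‖u‖)₊` of soft thresholding. -/
theorem exists_sub_projBall_eq_smul {r : ℝ} (hr : 0 ≤ r) (u : EuclideanSpace ℝ (Fin M)) :
    ∃ c : ℝ, 0 ≤ c ∧ u - projBall r u = c • u ∧
      inner ℝ (projBall r u) (c • u) = r * ‖c • u‖ := by
  unfold projBall
  split_ifs with h
  · exact ⟨0, le_rfl, by simp, by simp⟩
  · have hru := not_le.1 h
    have hu : 0 < ‖u‖ := hr.trans_lt hru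
    have hc : 0 ≤ 1 - r / ‖u‖ := by
      rw [sub_nonneg, div_le_one hu]; exact hru.le
    refine ⟨1 - r / ‖u‖, hc, by rw [sub_smul, one_smul], ?_⟩
    rw [inner_smul_left, inner_smul_right, real_inner_self_eq_norm_sq, norm_smul,
      Real.norm_of_nonneg hc]
    simp only [conj_trivial]
    field_simp

variable [NeZero M]

/-- `w = γ₁ + γ₂` with `γ₁ ∈ ρ₁ ∂‖·‖(z)` and `γ₂ ∈ ρ₂ ∂‖(·)_{-1}‖(z)`. -/
def IsBlockSubgrad (ρ₁ ρ₂ : ℝ) (z w : EuclideanSpace ℝ (Fin M)) : Prop :=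
  ∃ γ₁ γ₂ : EuclideanSpace ℝ (Fin M), w = γ₁ + γ₂ ∧ ‖γ₁‖ ≤ ρ₁ ∧ ‖γ₂‖ ≤ ρ₂ ∧ nonlin γ₂ = γ₂ ∧
    inner ℝ γ₁ z = ρ₁ * ‖z‖ ∧ inner ℝ γ₂ z = ρ₂ * ‖nonlin z‖

/-- The second projection leaves `z = b • (g - γ₂)` with `b ≥ 0`, and the first leaves `nonlin g -
γ₂ = c • nonlin g` with `c ≥ 0`. Hence `nonlin z` is a nonnegative multiple of `c • nonlin g`, with
which `γ₂` is already aligned: computing `γ₁` afterwards does not spoil the optimality of `γ₂`, so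
no second pass is needed. -/
theorem dualPass_isBlockSubgrad {lam α t : ℝ} (hlam : 0 ≤ lam) (hα0 : 0 ≤ α) (hα1 : α ≤ 1)
    (ht : 0 < t) (g : EuclideanSpace ℝ (Fin M)) :
    IsBlockSubgrad (lam * α) (lam * (1 - α)) (dualPass lam α t g)
      ((1 / t) • (g - dualPass lam α t g)) := by
  have h1 : 0 ≤ 1 - α := sub_nonneg.2 hα1
  have hr₂ : 0 ≤ t * lam * (1 - α) := by positivity
  have hr₁ : 0 ≤ t * lam * α := by positivity
  set γ₂ := projBall (t * lam * (1 - α)) (nonlin g) with hγ₂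
  set γ₁ := projBall (t * lam * α) (g - γ₂) with hγ₁
  have hz : dualPass lam α t g = g - γ₁ - γ₂ := rfl
  obtain ⟨c, hc, hce, hci⟩ := exists_sub_projBall_eq_smul hr₂ (nonlin g)
  obtain ⟨b, hb, hbe, hbi⟩ := exists_sub_projBall_eq_smul hr₁ (g - γ₂)
  rw [← hγ₂] at hce hci
  rw [← hγ₁] at hbe hbi
  have hz' : dualPass lam α t g = b • (g - γ₂) := by rw [hz, ← hbe]; abel
  have hγ₂n : nonlin γ₂ = γ₂ := by
    rw [show γ₂ = nonlin g - c • nonlin g by rw [← hce]; abel, nonlin_sub, nonlin_smul,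
      nonlin_nonlin]
  have hzn : nonlin (dualPass lam α t g) = b • (c • nonlin g) := by
    rw [hz', nonlin_smul, nonlin_sub, hγ₂n, hce]
  have ht' : (0 : ℝ) ≤ 1 / t := by positivity
  refine ⟨(1 / t) • γ₁, (1 / t) • γ₂, ?_, ?_, ?_, ?_, ?_, ?_⟩
  · rw [← smul_add, hz]
    congr 1
    abel
  · rw [norm_smul, Real.norm_of_nonneg ht']
    refine (mul_le_mul_of_nonneg_left (norm_projBall_le hr₁ _) ht').trans_eq ?_
    field_simp
  · rw [norm_smul, Real.norm_of_nonneg ht']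
    refine (mul_le_mul_of_nonneg_left (norm_projBall_le hr₂ _) ht').trans_eq ?_
    field_simp
  · rw [nonlin_smul, hγ₂n]
  · rw [hz', inner_smul_left, hbi]
    simp only [conj_trivial]
    field_simp
  · rw [← hγ₂n, ← nonlin_smul, ← inner_nonlin_right, hzn, inner_smul_left, inner_smul_right, hci,
      norm_smul b, Real.norm_of_nonneg hb]
    simp only [conj_trivial]
    field_simp

theorem IsBlockSubgrad.le {ρ₁ ρ₂ : ℝ} {z w : EuclideanSpace ℝ (Fin M)}
    (h : IsBlockSubgrad ρ₁ ρ₂ z w) (u : EuclideanSpace ℝ (Fin M)) :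
    ρ₁ * ‖z‖ + ρ₂ * ‖nonlin z‖ + inner ℝ w (u - z) ≤ ρ₁ * ‖u‖ + ρ₂ * ‖nonlin u‖ := by
  obtain ⟨γ₁, γ₂, rfl, h1, h2, h3, h4, h5⟩ := h
  rw [inner_sub_right, inner_add_left, inner_add_left, h4, h5, ← h3, ← inner_nonlin_right]
  have e1 := (real_inner_le_norm γ₁ u).trans (mul_le_mul_of_nonneg_right h1 (norm_nonneg u))
  have e2 := (real_inner_le_norm γ₂ (nonlin u)).trans
    (mul_le_mul_of_nonneg_right h2 (norm_nonneg _))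
  linarith

end DualPass

/-! ### The trial step: optimality, framework direction, Armijo rule and descent. -/

section Step
variable {p M : ℕ} [NeZero M] {L : Coef p M → ℝ} {C : Fin p → ℝ} {lam α : ℝ}

theorem lam_mul_splamPenalty (lam α : ℝ) (β : Coef p M) :
    lam * splamPenalty α β = ∑ j, (lam * α * ‖β j‖ + lam * (1 - α) * ‖nonlin (β j)‖) := by
  rw [splamPenalty, Finset.mul_sum]
  exact Finset.sum_congr rfl fun j _ => by ring

/-- Block subgradients at every block make up a subgradient of the penalty. -/
theorem penalty_add_inner_le {β w : Coef p M}
    (hw : ∀ j, IsBlockSubgrad (lam * α) (lam * (1 - α)) (β j) (w j)) (u : Coef p M) :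
    lam * splamPenalty α β + inner ℝ w (u - β) ≤ lam * splamPenalty α u := by
  rw [lam_mul_splamPenalty, lam_mul_splamPenalty, PiLp.inner_apply, ← Finset.sum_add_distrib]
  exact Finset.sum_le_sum fun j _ => (hw j).le (u j)

theorem penalty_add_inner_le_of_supported {β u w : Coef p M} {j : Fin p}
    (hw : IsBlockSubgrad (lam * α) (lam * (1 - α)) (β j) (w j)) (hu : ∀ i, i ≠ j → u i = β i) :
    lam * splamPenalty α β + inner ℝ w (u - β) ≤ lam * splamPenalty α u := by
  rw [lam_mul_splamPenalty, lam_mul_splamPenalty, PiLp.inner_apply, ← Finset.sum_add_distrib]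
  refine Finset.sum_le_sum fun i _ => ?_
  by_cases hij : i = j
  · subst hij; exact hw.le (u i)
  · simp [hu i hij]

variable (hlam : 0 ≤ lam) (hα0 : 0 ≤ α) (hα1 : α ≤ 1)
include hlam hα0 hα1

/-- This is the first-order optimality condition of the block subproblem; the later arguments use
the projections only through it. -/
theorem trialBlock_isBlockSubgrad (L : Coef p M → ℝ) (β : Coef p M) (j : Fin p) {t : ℝ}
    (ht : 0 < t) :
    IsBlockSubgrad (lam * α) (lam * (1 - α)) (trialBlock L lam α β j t)
      (-(blockGrad L β j + (1 / t) • (trialBlock L lam α β j t - β j))) := by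
  have h := dualPass_isBlockSubgrad hlam hα0 hα1 ht (β j - t • blockGrad L β j)
  have e : (1 / t) • (β j - t • blockGrad L β j - trialBlock L lam α β j t) =
      -(blockGrad L β j + (1 / t) • (trialBlock L lam α β j t - β j)) := by
    rw [sub_right_comm, smul_sub, smul_smul, one_div_mul_cancel ht.ne', one_smul,
      ← neg_sub (trialBlock L lam α β j t) (β j), smul_neg]
    abel
  rw [← e]
  exact h

/-- The subgradient inequality for the penalty after a trial step. -/
theorem penalty_trial_le (L : Coef p M → ℝ) (β : Coef p M) (j : Fin p) {t : ℝ}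
    (ht : 0 < t) {u : Coef p M} (hu : ∀ i, i ≠ j → u i = β i) :
    lam * splamPenalty α (setBlock β j (trialBlock L lam α β j t)) -
      inner ℝ (blockGrad L β j + (1 / t) • (trialBlock L lam α β j t - β j))
        (u j - trialBlock L lam α β j t) ≤ lam * splamPenalty α u := by
  set z := trialBlock L lam α β j t with hz
  have h := penalty_add_inner_le_of_supported (lam := lam) (α := α) (β := setBlock β j z) (j := j)
    (u := u) (w := setBlock 0 j (-(blockGrad L β j + (1 / t) • (z - β j))))
    (by simpa using trialBlock_isBlockSubgrad hlam hα0 hα1 L β j ht)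
    (fun i hi => by rw [hu i hi, setBlock_apply_of_ne β z hi])
  rw [inner_of_supported (j := j)] at h
  · rwa [PiLp.sub_apply, setBlock_apply_self, setBlock_apply_self, inner_neg_left,
      ← sub_eq_add_neg] at h
  · intro i hi
    rw [PiLp.sub_apply, hu i hi, setBlock_apply_of_ne β z hi, sub_self]

omit [NeZero M] hlam hα0 hα1 in
theorem inner_smul_id (t : ℝ) (e : Coef p M) :
    inner ℝ e (((1 / t) • ContinuousLinearMap.id ℝ (Coef p M)) e) = 1 / t * ‖e‖ ^ 2 := by
  simp [inner_smul_right]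

theorem trial_isCGDDirection (L : Coef p M → ℝ) (β : Coef p M) (j : Fin p) {t : ℝ} (ht : 0 < t) :
    IsCGDDirection L (fun β => lam * splamPenalty α β) β j
      ((1 / t) • ContinuousLinearMap.id ℝ (Coef p M))
      (setBlock β j (trialBlock L lam α β j t) - β) := by
  refine ⟨fun i hi => setBlock_sub_apply_of_ne β _ hi, fun e he => ?_⟩
  have he' : ∀ i, i ≠ j → e i = 0 := he
  have h := penalty_trial_le hlam hα0 hα1 L β j ht (u := β + e) (fun i hi => by simp [he' i hi])
  set z := trialBlock L lam α β j t with hz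
  simp only [Set.mem_ofPred_eq, inner_smul_id]
  rw [add_sub_cancel, inner_setBlock_sub, norm_setBlock_sub, inner_of_supported he']
  have hne : ‖e‖ ^ 2 = ‖e j‖ ^ 2 := by
    rw [← real_inner_self_eq_norm_sq, inner_of_supported he', real_inner_self_eq_norm_sq]
  rw [hne]
  set d := z - β j with hd
  have e1 : (β + e) j - z = e j - d := by rw [hd, PiLp.add_apply]; abel
  clear_value d
  rw [e1, inner_add_left, inner_sub_right, inner_sub_right, inner_smul_left, inner_smul_left,
    real_inner_self_eq_norm_sq] at h
  simp only [conj_trivial, blockGrad] at h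
  -- The subgradient inequality contributes the cross term `⟪d, e j⟫ / t`; completing the square
  -- turns it into the difference of the two quadratic terms.
  have h2 : 0 ≤ 1 / (2 * t) * ‖e j - d‖ ^ 2 := by positivity
  rw [norm_sub_sq_real, real_inner_comm] at h2
  have e3 : 1 / (2 * t) * (‖e j‖ ^ 2 - 2 * inner ℝ d (e j) + ‖d‖ ^ 2) =
    1 / 2 * (1 / t * ‖e j‖ ^ 2) - 1 / t * inner ℝ d (e j) + 1 / 2 * (1 / t * ‖d‖ ^ 2) := by
    field_simp
  rw [e3] at h2
  linarith

omit hlam hα0 hα1 in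
-- With `σ = 1` and unit step, the values of the penalty at both points cancel from the Armijo rule,
-- and `γ = 1/2` makes the quadratic term `‖d‖² / (2t)`. What remains is the backtracking inequality
-- itself.
theorem accepts_iff_armijo (L : Coef p M → ℝ) (lam α : ℝ) (β : Coef p M) (j : Fin p) (t : ℝ) :
    Accepts L lam α β j t ↔ Armijo L (fun β => lam * splamPenalty α β) 1 (1 / 2) β
      ((1 / t) • ContinuousLinearMap.id ℝ (Coef p M))
      (setBlock β j (trialBlock L lam α β j t) - β) 1 := by
  unfold Accepts Armijo cgdDelta
  rw [inner_smul_id, inner_setBlock_sub, norm_setBlock_sub, one_smul, add_sub_cancel,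
    real_inner_comm]
  have e : 1 / (2 * t) = 1 / 2 * (1 / t) := by rw [one_div_mul_one_div]
  rw [e, blockGrad]
  constructor <;> intro h <;> linarith

/-- The subgradient inequality tested at `β` gains `‖d‖² / t` for the step `d`; the backtracking
inequality spends half of it. -/
theorem Accepts.descent {β : Coef p M} {j : Fin p} {t : ℝ}
    (h : Accepts L lam α β j t) (ht : 0 < t) :
    splamObj L lam α (setBlock β j (trialBlock L lam α β j t)) +
      1 / (2 * t) * ‖trialBlock L lam α β j t - β j‖ ^ 2 ≤ splamObj L lam α β := by
  have h1 := penalty_trial_le hlam hα0 hα1 L β j ht (u := β) (fun _ _ => rfl)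
  unfold Accepts at h
  set z := trialBlock L lam α β j t with hz
  rw [← neg_sub z, inner_neg_right, inner_add_left, inner_smul_left,
    real_inner_self_eq_norm_sq, real_inner_comm] at h1
  simp only [conj_trivial] at h1
  have e : 1 / t * ‖z - β j‖ ^ 2 = 2 * (1 / (2 * t) * ‖z - β j‖ ^ 2) := by field_simp
  rw [e] at h1
  unfold splamObj
  linarith

omit hlam hα0 hα1 in
theorem accepts_of_le (hC : BlockLipschitz L C) (hL : Differentiable ℝ L) (hCpos : ∀ j, 0 < C j)
    (β : Coef p M) (j : Fin p) {t : ℝ} (ht : 0 < t) (htC : t ≤ 1 / C j) :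
    Accepts L lam α β j t := by
  refine (hC.descent hL β j _).trans ?_
  have : C j / 2 ≤ 1 / (2 * t) := by
    rw [div_le_div_iff₀ two_pos (by positivity)]
    have := (le_div_iff₀ (hCpos j)).1 htC
    linarith
  gcongr

/-- At a minimizer, minus the gradient is a block subgradient of the penalty. -/
theorem isBlockSubgrad_of_mem_minimizers (hC : BlockLipschitz L C) (hL : Differentiable ℝ L)
    (hCpos : ∀ j, 0 < C j) {β : Coef p M} (hβ : β ∈ minimizers (splamObj L lam α)) (j : Fin p) :
    IsBlockSubgrad (lam * α) (lam * (1 - α)) (β j) (-(gradient L β j)) := by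
  have ht : 0 < 1 / C j := one_div_pos.2 (hCpos j)
  -- A step of size `1 / C j` is always accepted. Since it cannot decrease the objective at a
  -- minimizer, it does not move the block, and its optimality condition becomes the claim.
  have h1 := Accepts.descent hlam hα0 hα1
    (accepts_of_le (lam := lam) (α := α) hC hL hCpos β j ht le_rfl) ht
  have h2 := hβ (setBlock β j (trialBlock L lam α β j (1 / C j)))
  have h3 := trialBlock_isBlockSubgrad hlam hα0 hα1 L β j ht
  set z := trialBlock L lam α β j (1 / C j) with hz
  have h4 : 1 / (2 * (1 / C j)) * ‖z - β j‖ ^ 2 ≤ 0 := by linarith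
  have h5 : 0 < 1 / (2 * (1 / C j)) := by positivity
  have h6 : ‖z - β j‖ ^ 2 = 0 :=
    le_antisymm (nonpos_of_mul_nonpos_right h4 h5) (sq_nonneg _)
  have h7 : z = β j := by
    rw [sq_eq_zero_iff, norm_eq_zero, sub_eq_zero] at h6; exact h6
  rw [h7, sub_self, smul_zero, add_zero] at h3
  exact h3

end Step

/-! ### Backtracking: termination and bounds on the accepted step size. -/

section Backtracking
variable {shrink : ℝ → ℝ → ℝ} {η c t : ℝ}

theorem backtrackStep_succ (shrink : ℝ → ℝ → ℝ) (η c t : ℝ) (m : ℕ) :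
    backtrackStep shrink η c t (m + 1) = shrink (η * backtrackStep shrink η c t m) (1 / c) := by
  simp only [backtrackStep, Function.iterate_succ_apply']

theorem backtrackStep_pos (hshrink : shrink = max ∨ shrink = min) (hη0 : 0 < η) (hc : 0 < c)
    (ht : 0 < t) (m : ℕ) : 0 < backtrackStep shrink η c t m := by
  induction m with
  | zero => exact ht
  | succ m ih =>
    rw [backtrackStep_succ]
    have h1 : 0 < η * backtrackStep shrink η c t m := mul_pos hη0 ih
    have h2 : 0 < 1 / c := one_div_pos.2 hc
    rcases hshrink with rfl | rfl
    · exact lt_max_of_lt_left h1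
    · exact lt_min h1 h2

theorem backtrackStep_le (hshrink : shrink = max ∨ shrink = min) (hη0 : 0 < η) (hη1 : η < 1)
    (hc : 0 < c) (m : ℕ) :
    backtrackStep shrink η c t m ≤ max (η ^ m * t) (1 / c) := by
  induction m with
  | zero => simp [backtrackStep]
  | succ m ih =>
    rw [backtrackStep_succ]
    have hc' : 0 < 1 / c := one_div_pos.2 hc
    have h1 : η * backtrackStep shrink η c t m ≤ max (η ^ (m + 1) * t) (1 / c) := by
      refine (mul_le_mul_of_nonneg_left ih hη0.le).trans ?_
      rw [mul_max_of_nonneg _ _ hη0.le, pow_succ', mul_assoc]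
      exact max_le_max le_rfl (mul_le_of_le_one_left hc'.le hη1.le)
    rcases hshrink with rfl | rfl
    · exact max_le h1 (le_max_right _ _)
    · exact (min_le_left _ _).trans h1

theorem exists_backtrackStep_le (hshrink : shrink = max ∨ shrink = min) (hη0 : 0 < η)
    (hη1 : η < 1) (hc : 0 < c) (ht : 0 < t) : ∃ m, backtrackStep shrink η c t m ≤ 1 / c := by
  have hc' : 0 < 1 / c := one_div_pos.2 hc
  obtain ⟨m, hm⟩ := exists_pow_lt_of_lt_one (div_pos hc' ht) hη1
  exact ⟨m, (backtrackStep_le hshrink hη0 hη1 hc m).trans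
    (max_le ((lt_div_iff₀ ht).1 hm).le le_rfl)⟩

end Backtracking

section Accepted
variable {p M : ℕ} [NeZero M] {L : Coef p M → ℝ} {C : Fin p → ℝ} {lam α : ℝ}
  {shrink : ℝ → ℝ → ℝ} {η t : ℝ}

theorem exists_accepts_backtrackStep (hC : BlockLipschitz L C) (hL : Differentiable ℝ L)
    (hCpos : ∀ j, 0 < C j) (hshrink : shrink = max ∨ shrink = min) (hη0 : 0 < η) (hη1 : η < 1)
    (ht : 0 < t) (lam α : ℝ) (β : Coef p M) (j : Fin p) :
    ∃ m, Accepts L lam α β j (backtrackStep shrink η (C j) t m) := by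
  obtain ⟨m, hm⟩ := exists_backtrackStep_le hshrink hη0 hη1 (hCpos j) ht
  exact ⟨m, accepts_of_le hC hL hCpos β j (backtrackStep_pos hshrink hη0 (hCpos j) ht m) hm⟩

theorem accepts_acceptedStep (hC : BlockLipschitz L C) (hL : Differentiable ℝ L)
    (hCpos : ∀ j, 0 < C j) (hshrink : shrink = max ∨ shrink = min) (hη0 : 0 < η) (hη1 : η < 1)
    (ht : 0 < t) (lam α : ℝ) (β : Coef p M) (j : Fin p) :
    Accepts L lam α β j (acceptedStep L lam α shrink η C β j t) :=
  Nat.sInf_mem (exists_accepts_backtrackStep hC hL hCpos hshrink hη0 hη1 ht lam α β j)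

theorem acceptedStep_le (hCpos : ∀ j, 0 < C j) (hshrink : shrink = max ∨ shrink = min)
    (hη0 : 0 < η) (hη1 : η < 1) (ht : 0 < t) (lam α : ℝ) (β : Coef p M) (j : Fin p) :
    acceptedStep L lam α shrink η C β j t ≤ max t (1 / C j) :=
  (backtrackStep_le hshrink hη0 hη1 (hCpos j) _).trans
    (max_le_max (mul_le_of_le_one_left ht.le (pow_le_one₀ hη0.le hη1.le)) le_rfl)

/-- Under the `max` rule a rejection never leaves the step below `1 / C j`. Under the `min` rule the
last rejected step exceeded `1 / C j`, as it would otherwise have been accepted, so its successor is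
at least `η / C j`. -/
theorem min_le_acceptedStep (hC : BlockLipschitz L C) (hL : Differentiable ℝ L)
    (hCpos : ∀ j, 0 < C j) (hshrink : shrink = max ∨ shrink = min) (hη0 : 0 < η) (hη1 : η < 1)
    (ht : 0 < t) (lam α : ℝ) (β : Coef p M) (j : Fin p) :
    min t (η / C j) ≤ acceptedStep L lam α shrink η C β j t := by
  unfold acceptedStep
  set k := sInf {m : ℕ | Accepts L lam α β j (backtrackStep shrink η (C j) t m)} with hk
  rcases hkm : k with _ | m
  · exact min_le_left _ _
  · refine (min_le_right _ _).trans ?_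
    have hcj := hCpos j
    have hη : η / C j ≤ 1 / C j := by gcongr
    rw [backtrackStep_succ]
    rcases hshrink with rfl | rfl
    · exact hη.trans (le_max_right _ _)
    · refine le_min ?_ hη
      have hm : m ∉ {m : ℕ | Accepts L lam α β j (backtrackStep min η (C j) t m)} :=
        Nat.notMem_of_lt_sInf (by omega)
      have h1 : 1 / C j < backtrackStep min η (C j) t m := by
        by_contra! hle
        exact hm (accepts_of_le hC hL hCpos β j
          (backtrackStep_pos (Or.inr rfl) hη0 hcj ht m) hle)
      rw [div_eq_mul_one_div]
      gcongr

theorem min_le_acceptedStep_max (lam α : ℝ) (β : Coef p M) (j : Fin p) :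
    min t (1 / C j) ≤ acceptedStep L lam α max η C β j t := by
  unfold acceptedStep
  rcases sInf {m : ℕ | Accepts L lam α β j (backtrackStep max η (C j) t m)} with _ | m
  · exact min_le_left _ _
  · rw [backtrackStep_succ]
    exact (min_le_right _ _).trans (le_max_right _ _)

end Accepted

/-! ### Step size bounds along the whole algorithm. -/

section State
variable {p M : ℕ} [NeZero p] [NeZero M] {L : Coef p M → ℝ} {C : Fin p → ℝ} {lam α : ℝ}
  {shrink : ℝ → ℝ → ℝ} {η : ℝ} {t0 : Fin p → ℝ} {β0 : Coef p M}

/-- A bound on the step sizes that is kept by every inner loop is kept throughout. -/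
theorem bcgdState_snd_induction {P : Fin p → ℝ → Prop} (h0 : ∀ j, P j (t0 j))
    (hstep : ∀ β j t, P j t → P j (acceptedStep L lam α shrink η C β j t)) (n : ℕ) (j : Fin p) :
    P j ((bcgdState L lam α shrink η C t0 β0 n).2 j) := by
  induction n generalizing j with
  | zero => exact h0 j
  | succ n ih =>
    simp only [bcgdState]
    by_cases hj : j = cyclicBlock p n
    · subst hj
      rw [Function.update_self]
      exact hstep _ _ _ (ih _)
    · rw [Function.update_of_ne hj]
      exact ih j

theorem bcgdState_snd_bounds (hC : BlockLipschitz L C) (hL : Differentiable ℝ L)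
    (hCpos : ∀ j, 0 < C j) (hshrink : shrink = max ∨ shrink = min) (hη0 : 0 < η) (hη1 : η < 1)
    (ht0 : ∀ j, 0 < t0 j) (n : ℕ) (j : Fin p) :
    min (t0 j) (η / C j) ≤ (bcgdState L lam α shrink η C t0 β0 n).2 j ∧
      (bcgdState L lam α shrink η C t0 β0 n).2 j ≤ max (t0 j) (1 / C j) := by
  refine bcgdState_snd_induction (L := L) (lam := lam) (α := α)
    (P := fun j t => min (t0 j) (η / C j) ≤ t ∧ t ≤ max (t0 j) (1 / C j))
    (fun j => ⟨min_le_left _ _, le_max_left _ _⟩) (fun β j t h => ?_) n j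
  have ht : 0 < t := (lt_min (ht0 j) (div_pos hη0 (hCpos j))).trans_le h.1
  exact ⟨(le_min h.1 (min_le_right _ _)).trans
      (min_le_acceptedStep hC hL hCpos hshrink hη0 hη1 ht lam α β j),
    (acceptedStep_le hCpos hshrink hη0 hη1 ht lam α β j).trans (max_le h.2 (le_max_right _ _))⟩

theorem bcgdState_snd_max_ge (n : ℕ) (j : Fin p) :
    min (t0 j) (1 / C j) ≤ (bcgdState L lam α max η C t0 β0 n).2 j :=
  bcgdState_snd_induction (L := L) (lam := lam) (α := α)
    (P := fun j t => min (t0 j) (1 / C j) ≤ t) (fun _ => min_le_left _ _)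
    (fun β j _ h => (le_min h (min_le_right _ _)).trans (min_le_acceptedStep_max lam α β j)) n j

theorem one_div_le_max_of_min_le {a b t : ℝ} (ha : 0 < a) (hb : 0 < b) (h : min a b ≤ t) :
    1 / t ≤ max (1 / b) (1 / a) := by
  rcases min_le_iff.1 h with h | h
  · exact (one_div_le_one_div_of_le ha h).trans (le_max_right _ _)
  · exact (one_div_le_one_div_of_le hb h).trans (le_max_left _ _)

theorem min_le_one_div_of_le_max {a b t : ℝ} (ht : 0 < t) (h : t ≤ max a b) :
    min (1 / b) (1 / a) ≤ 1 / t := by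
  rcases le_max_iff.1 h with h | h
  · exact (min_le_right _ _).trans (one_div_le_one_div_of_le ht h)
  · exact (min_le_left _ _).trans (one_div_le_one_div_of_le ht h)

end State

/-! ### Every block occurs exactly once among `p` consecutive updates. -/

section Cyclic
variable {p : ℕ} [NeZero p]

theorem cyclicBlock_add_injective (n : ℕ) :
    Function.Injective fun i : Fin p => cyclicBlock p (n + i) := by
  intro a b hab
  have h : (n + a) % p = (n + b) % p := congrArg Fin.val hab
  have h2 : (a : ℕ) ≡ b [MOD p] := Nat.ModEq.add_left_cancel' n h
  exact Fin.ext (by simpa [Nat.ModEq, Nat.mod_eq_of_lt a.2, Nat.mod_eq_of_lt b.2] using h2)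

theorem cyclicBlock_add_surjective (n : ℕ) :
    Function.Surjective fun i : Fin p => cyclicBlock p (n + i) :=
  Finite.surjective_of_injective (cyclicBlock_add_injective n)

end Cyclic

/-! ### Cyclic proximal runs: sufficient decrease, subgradients and cluster points. -/

section Run
variable {p M : ℕ} [NeZero p] [NeZero M] {L : Coef p M → ℝ} {C : Fin p → ℝ} {lam α θ Θ : ℝ}
  {x : ℕ → Coef p M} {t : ℕ → ℝ}

/-- A cyclic run of accepted trial steps with step sizes `t n`, `θ ≤ 1 / t n ≤ Θ`. -/
structure IsProxRun (L : Coef p M → ℝ) (lam α θ Θ : ℝ) (x : ℕ → Coef p M) (t : ℕ → ℝ) :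
    Prop where
  theta_pos : 0 < θ
  step_pos : ∀ n, 0 < t n
  lower : ∀ n, θ ≤ 1 / t n
  upper : ∀ n, 1 / t n ≤ Θ
  update : ∀ n, x (n + 1) = setBlock (x n) (cyclicBlock p n)
    (trialBlock L lam α (x n) (cyclicBlock p n) (t n))
  accepts : ∀ n, Accepts L lam α (x n) (cyclicBlock p n) (t n)

theorem IsProxRun.descent (hx : IsProxRun L lam α θ Θ x t) (hlam : 0 ≤ lam) (hα0 : 0 ≤ α)
    (hα1 : α ≤ 1) (n : ℕ) :
    splamObj L lam α (x (n + 1)) + θ / 2 * ‖x (n + 1) - x n‖ ^ 2 ≤ splamObj L lam α (x n) := by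
  refine le_trans ?_ ((hx.accepts n).descent hlam hα0 hα1 (hx.step_pos n))
  rw [← hx.update, hx.update, norm_setBlock_sub, ← hx.update]
  have h : θ / 2 ≤ 1 / (2 * t n) := by
    rw [mul_comm, ← div_div]
    linarith [hx.lower n]
  gcongr

theorem IsProxRun.antitone (hx : IsProxRun L lam α θ Θ x t) (hlam : 0 ≤ lam) (hα0 : 0 ≤ α)
    (hα1 : α ≤ 1) : Antitone fun n => splamObj L lam α (x n) := by
  refine antitone_nat_of_succ_le fun n => ?_
  have h1 := hx.descent hlam hα0 hα1 n
  have h2 : 0 ≤ θ / 2 * ‖x (n + 1) - x n‖ ^ 2 := by have := hx.theta_pos; positivity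
  linarith

theorem IsProxRun.sum_sq_le (hx : IsProxRun L lam α θ Θ x t) (hlam : 0 ≤ lam) (hα0 : 0 ≤ α)
    (hα1 : α ≤ 1) (n k : ℕ) :
    θ / 2 * ∑ i ∈ Finset.range k, ‖x (n + i + 1) - x (n + i)‖ ^ 2 ≤
      splamObj L lam α (x n) - splamObj L lam α (x (n + k)) := by
  induction k with
  | zero => simp
  | succ k ih =>
    rw [Finset.sum_range_succ, mul_add]
    have := hx.descent hlam hα0 hα1 (n + k)
    rw [← add_assoc]
    linarith

theorem IsProxRun.apply_eq_of_ne (hx : IsProxRun L lam α θ Θ x t) {n : ℕ} {j : Fin p}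
    (hj : j ≠ cyclicBlock p n) : x (n + 1) j = x n j := by
  rw [hx.update, setBlock_apply_of_ne _ _ hj]

/-- Each block is updated once in a window of `p` updates, and keeps its value afterwards. -/
theorem IsProxRun.exists_last_update (hx : IsProxRun L lam α θ Θ x t) (n : ℕ) (j : Fin p) :
    ∃ i < p, cyclicBlock p (n + i) = j ∧ x (n + p) j = x (n + i + 1) j := by
  obtain ⟨i, hi⟩ := cyclicBlock_add_surjective n j
  refine ⟨i, i.2, hi, ?_⟩
  have h : ∀ k, (i : ℕ) + 1 + k ≤ p → x (n + (i + 1 + k)) j = x (n + i + 1) j := by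
    intro k
    induction k with
    | zero => intro _; rfl
    | succ k ih =>
      intro hk
      rw [← ih (by omega)]
      refine hx.apply_eq_of_ne fun hj => ?_
      have := cyclicBlock_add_injective n (a₁ := i) (a₂ := ⟨i + 1 + k, by omega⟩) (hi.trans hj)
      rw [Fin.ext_iff] at this
      simp at this
      omega
  have := h (p - (i + 1)) (by omega)
  rwa [Nat.add_sub_of_le (by omega)] at this

omit [NeZero p] [NeZero M] in
theorem norm_window_le (x : ℕ → Coef p M) (n k i : ℕ) (hi : i ≤ k) :
    ‖x (n + k) - x (n + i)‖ ≤ ∑ i ∈ Finset.range k, ‖x (n + i + 1) - x (n + i)‖ := by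
  have h := dist_le_Ico_sum_dist (fun i => x (n + i)) hi
  rw [dist_comm, dist_eq_norm] at h
  refine h.trans ?_
  rw [Finset.range_eq_Ico]
  refine (Finset.sum_le_sum_of_subset_of_nonneg (Finset.Ico_subset_Ico_left (Nat.zero_le i))
    fun _ _ _ => dist_nonneg).trans_eq (Finset.sum_congr rfl fun m _ => ?_)
  rw [dist_comm, dist_eq_norm, add_assoc]

/-- After a full cycle, some subgradient of the objective is controlled by the decrease. -/
theorem IsProxRun.exists_subgradient (hx : IsProxRun L lam α θ Θ x t) (hlam : 0 ≤ lam)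
    (hα0 : 0 ≤ α) (hα1 : α ≤ 1) (hC : BlockLipschitz L C) (hc : ConvexOn ℝ Set.univ L)
    (hL : Differentiable ℝ L) (hCpos : ∀ j, 0 < C j) :
    ∃ K > 0, ∀ n, ∃ w : Coef p M,
      (∀ u, lam * splamPenalty α (x (n + p)) + inner ℝ w (u - x (n + p)) ≤
        lam * splamPenalty α u) ∧
      ‖gradient L (x (n + p)) + w‖ ^ 2 ≤
        K * (splamObj L lam α (x n) - splamObj L lam α (x (n + p))) ∧
      ‖x (n + p) - x n‖ ^ 2 ≤
        K * (splamObj L lam α (x n) - splamObj L lam α (x (n + p))) := by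
  have hp : (0 : ℝ) < p := by exact_mod_cast Nat.pos_of_ne_zero (NeZero.ne p)
  have hθ := hx.theta_pos
  have hΘ : 0 < Θ := hθ.trans_le ((hx.lower 0).trans (hx.upper 0))
  set Λ := p * ∑ j, C j with hΛ
  have hΛ0 : 0 < Λ := mul_pos hp (Finset.sum_pos (fun j _ => hCpos j) Finset.univ_nonempty)
  -- The factor `p * (2 / θ)` bounds the squared path length of the cycle by the decrease, and `p *
  -- (Λ + Θ) ^ 2` bounds the subgradient by the path length. The extra `1` makes the same constant
  -- serve for the displacement.
  refine ⟨(p * (Λ + Θ) ^ 2 + 1) * (p * (2 / θ)), by positivity, fun n => ?_⟩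
  choose i hip hi hxi using hx.exists_last_update n
  set S := ∑ i ∈ Finset.range p, ‖x (n + i + 1) - x (n + i)‖ with hS
  have hS0 : 0 ≤ S := Finset.sum_nonneg fun _ _ => norm_nonneg _
  have hS2 : S ^ 2 ≤ p * (2 / θ) * (splamObj L lam α (x n) - splamObj L lam α (x (n + p))) := by
    have h1 := sq_sum_le_card_mul_sum_sq (s := Finset.range p)
      (f := fun i => ‖x (n + i + 1) - x (n + i)‖)
    rw [Finset.card_range, ← hS] at h1
    refine h1.trans ?_
    rw [mul_assoc]
    refine mul_le_mul_of_nonneg_left ?_ hp.le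
    have h2 := mul_le_mul_of_nonneg_left (hx.sum_sq_le hlam hα0 hα1 n p)
      (by positivity : 0 ≤ 2 / θ)
    rwa [← mul_assoc, show 2 / θ * (θ / 2) = 1 by field_simp, one_mul] at h2
  -- Block `j` keeps its value after its last update in the cycle, so the optimality condition from
  -- that update still gives a block subgradient at `x (n + p)`. Only the gradient of `L` is
  -- outdated, and its error is controlled by `Λ * S`.
  set w : Coef p M := WithLp.toLp 2 fun j =>
    -(blockGrad L (x (n + i j)) j + (1 / t (n + i j)) • (x (n + i j + 1) j - x (n + i j) j)) with hw
  have hwj : ∀ j, w j = -(blockGrad L (x (n + i j)) j +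
    (1 / t (n + i j)) • (x (n + i j + 1) j - x (n + i j) j)) := fun j => rfl
  refine ⟨w, ?_, ?_, ?_⟩
  · refine penalty_add_inner_le fun j => ?_
    have h := trialBlock_isBlockSubgrad hlam hα0 hα1 L (x (n + i j)) j (hx.step_pos (n + i j))
    have e : trialBlock L lam α (x (n + i j)) j (t (n + i j)) = x (n + i j + 1) j := by
      rw [hx.update, hi, setBlock_apply_self]
    rw [e] at h
    rw [hxi, hwj]
    exact h
  · have h1 : ∀ j, ‖(gradient L (x (n + p)) + w) j‖ ≤ (Λ + Θ) * S := by
      intro j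
      have e : (gradient L (x (n + p)) + w) j =
          (gradient L (x (n + p)) - gradient L (x (n + i j))) j +
            -((1 / t (n + i j)) • (x (n + i j + 1) - x (n + i j)) j) := by
        rw [PiLp.add_apply, hwj, PiLp.sub_apply, PiLp.sub_apply, blockGrad]
        abel
      rw [e, add_mul]
      refine norm_add_le_of_le ?_ ?_
      · refine (PiLp.norm_apply_le (gradient L (x (n + p)) - gradient L (x (n + i j))) j).trans ?_
        refine (hC.norm_gradient_sub_le hc hL hCpos _ _).trans ?_
        exact mul_le_mul_of_nonneg_left (norm_window_le x n p (i j) (hip j).le) hΛ0.le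
      · rw [norm_neg, norm_smul, Real.norm_of_nonneg (one_div_pos.2 (hx.step_pos _)).le]
        refine mul_le_mul (hx.upper _) ?_ (norm_nonneg _) hΘ.le
        refine (PiLp.norm_apply_le (x (n + i j + 1) - x (n + i j)) j).trans ?_
        exact Finset.single_le_sum (f := fun i => ‖x (n + i + 1) - x (n + i)‖)
          (fun _ _ => norm_nonneg _) (Finset.mem_range.2 (hip j))
    have h2 : ‖gradient L (x (n + p)) + w‖ ^ 2 ≤ p * ((Λ + Θ) * S) ^ 2 := by
      rw [PiLp.norm_sq_eq_of_L2]
      refine (Finset.sum_le_card_nsmul _ _ (((Λ + Θ) * S) ^ 2) fun j _ => ?_).trans_eq (by simp)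
      exact pow_le_pow_left₀ (norm_nonneg ((gradient L (x (n + p)) + w) j)) (h1 j) 2
    refine h2.trans ?_
    rw [mul_pow, ← mul_assoc, mul_assoc _ _ (_ - _)]
    refine mul_le_mul (by linarith) hS2 (sq_nonneg _) (by positivity)
  · have h1 := norm_window_le x n p 0 (Nat.zero_le _)
    rw [add_zero] at h1
    refine (pow_le_pow_left₀ (norm_nonneg _) h1 2).trans ?_
    rw [mul_assoc]
    refine hS2.trans (le_mul_of_one_le_left ((sq_nonneg _).trans hS2) ?_)
    have : 0 ≤ p * (Λ + Θ) ^ 2 := by positivity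
    linarith

theorem Differentiable.continuous_real {E : Type*} [NormedAddCommGroup E] [NormedSpace ℝ E]
    {f : E → ℝ} (h : Differentiable ℝ f) : Continuous f :=
  h.continuous

theorem continuous_nonlin : Continuous (nonlin : EuclideanSpace ℝ (Fin M) → _) :=
  nonlinLin.continuous_of_finiteDimensional

omit [NeZero p] in
theorem continuous_splamObj (hL : Differentiable ℝ L) (lam α : ℝ) :
    Continuous (splamObj L lam α) := by
  have h : ∀ j, Continuous fun β : Coef p M => β j :=
    fun j => (continuous_apply j).comp (PiLp.continuous_ofLp 2 _)
  refine hL.continuous_real.add (continuous_const.mul (continuous_finsetSum _ fun j _ => ?_))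
  exact (continuous_const.mul (h j).norm).add
    (continuous_const.mul (continuous_nonlin.comp (h j)).norm)

omit [NeZero p] in
theorem splamObj_add_inner_le (hc : ConvexOn ℝ Set.univ L) (hL : Differentiable ℝ L)
    {y w : Coef p M} (hw : ∀ u, lam * splamPenalty α y + inner ℝ w (u - y) ≤
      lam * splamPenalty α u) (u : Coef p M) :
    splamObj L lam α y + inner ℝ (gradient L y + w) (u - y) ≤ splamObj L lam α u := by
  have h1 := hc.add_inner_gradient_le hL y u
  have h2 := hw u
  rw [inner_add_left]
  unfold splamObj
  linarith

variable (hx : IsProxRun L lam α θ Θ x t) (hlam : 0 ≤ lam)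
    (hα0 : 0 ≤ α) (hα1 : α ≤ 1) (hC : BlockLipschitz L C) (hc : ConvexOn ℝ Set.univ L)
    (hL : Differentiable ℝ L) (hCpos : ∀ j, 0 < C j)
include hx hlam hα0 hα1 hL

theorem IsProxRun.tendsto_obj_of_mapClusterPt {b : Coef p M} (hb : MapClusterPt b atTop x) :
    Tendsto (fun n => splamObj L lam α (x n)) atTop (𝓝 (splamObj L lam α b)) := by
  obtain ⟨ψ, hψ, hlim⟩ := hb.tendsto_subseq
  refine (tendsto_iff_tendsto_subseq_of_antitone (hx.antitone hlam hα0 hα1) hψ.tendsto_atTop).2 ?_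
  exact ((continuous_splamObj hL lam α).tendsto b).comp hlim

include hC hc hCpos

/-- The objective values converge, so the decrease over a cycle, and with it the subgradient at the
end of the cycle, tends to zero. The subgradient inequality then passes to the limit along the
subsequence. -/
theorem IsProxRun.mem_minimizers_of_mapClusterPt {b : Coef p M} (hb : MapClusterPt b atTop x) :
    b ∈ minimizers (splamObj L lam α) := by
  obtain ⟨K, hK, hw⟩ := hx.exists_subgradient hlam hα0 hα1 hC hc hL hCpos
  choose w hw1 hw2 _ using hw
  have hF := hx.tendsto_obj_of_mapClusterPt hlam hα0 hα1 hL hb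
  have hv : Tendsto (fun n => gradient L (x (n + p)) + w n) atTop (𝓝 0) := by
    have h1 : Tendsto (fun n => K * (splamObj L lam α (x n) - splamObj L lam α (x (n + p))))
        atTop (𝓝 0) := by
      simpa using (hF.sub (hF.comp (tendsto_add_atTop_nat p))).const_mul K
    have h2 := squeeze_zero (fun n => sq_nonneg _) hw2 h1
    have h3 := h2.sqrt
    simp only [Real.sqrt_sq (norm_nonneg _), Real.sqrt_zero] at h3
    exact tendsto_zero_iff_norm_tendsto_zero.2 h3
  obtain ⟨ψ, hψ, hlim⟩ := hb.tendsto_subseq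
  -- Subgradients are available only at points `x (n + p)`. Shifting the subsequence by `p` makes
  -- the natural subtraction `ψ (k + p) - p` a true one.
  have hge : ∀ k, p ≤ ψ (k + p) := fun k => (Nat.le_add_left p k).trans (hψ.id_le (k + p))
  have hφ : Tendsto (fun k => ψ (k + p) - p) atTop atTop :=
    tendsto_atTop_mono (fun k => Nat.le_sub_of_add_le (hψ.id_le (k + p))) tendsto_id
  have hxφ : Tendsto (fun k => x (ψ (k + p) - p + p)) atTop (𝓝 b) := by
    simp only [Nat.sub_add_cancel (hge _)]
    exact hlim.comp (tendsto_add_atTop_nat p)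
  intro u
  have hlim2 := (((continuous_splamObj hL lam α).tendsto b).comp hxφ).add
    ((hv.comp hφ).inner (𝕜 := ℝ) (tendsto_const_nhds (x := u) |>.sub hxφ))
  simp only [inner_zero_left, add_zero] at hlim2
  exact le_of_tendsto' hlim2 fun k => splamObj_add_inner_le hc hL (hw1 _) u

theorem IsProxRun.exists_minimizer_of_isBounded
    (hb : Bornology.IsBounded {β | splamObj L lam α β ≤ splamObj L lam α (x 0)}) :
    ∃ b ∈ minimizers (splamObj L lam α),
      Tendsto (fun n => splamObj L lam α (x n)) atTop (𝓝 (splamObj L lam α b)) := by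
  have hmem : ∀ n, x n ∈ {β | splamObj L lam α β ≤ splamObj L lam α (x 0)} :=
    fun n => hx.antitone hlam hα0 hα1 (Nat.zero_le n)
  obtain ⟨b, _, ψ, hψ, hlim⟩ := tendsto_subseq_of_bounded hb hmem
  have hcl : MapClusterPt b atTop x := hlim.mapClusterPt.of_comp hψ.tendsto_atTop
  exact ⟨b, hx.mem_minimizers_of_mapClusterPt hlam hα0 hα1 hC hc hL hCpos hcl,
    hx.tendsto_obj_of_mapClusterPt hlam hα0 hα1 hL hcl⟩

end Run

/-! ### Geometric bounds and R-linear convergence. -/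

theorem exists_geometric_bound {a : ℕ → ℝ} {q : ℝ} (ha : Antitone a) (ha0 : ∀ k, 0 ≤ a k)
    (hq0 : 0 < q) (hq1 : q < 1) (h : ∀ᶠ k in atTop, a (k + 1) ≤ q * a k) :
    ∃ D, 0 ≤ D ∧ ∀ k, a k ≤ D * q ^ k := by
  obtain ⟨k₀, hk₀⟩ := eventually_atTop.1 h
  refine ⟨a 0 / q ^ k₀, div_nonneg (ha0 0) (by positivity), fun k => ?_⟩
  rcases le_total k k₀ with hk | hk
  · rw [div_mul_eq_mul_div, le_div_iff₀ (by positivity)]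
    exact mul_le_mul (ha (Nat.zero_le k)) (pow_le_pow_of_le_one hq0.le hq1.le hk)
      (by positivity) (ha0 0)
  · induction k, hk using Nat.le_induction with
    | base =>
      rw [div_mul_cancel₀ _ (by positivity)]
      exact ha (Nat.zero_le _)
    | succ k hk ih =>
      refine (hk₀ k hk).trans ((mul_le_mul_of_nonneg_left ih hq0.le).trans_eq ?_)
      ring

/-- The increments decay like `√q ^ k`, so the sequence is Cauchy, and the tail of the geometric
series gives the rate. -/
theorem rLinear_of_sq_le {E : Type*} [NormedAddCommGroup E] [CompleteSpace E] {x : ℕ → E}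
    {D q : ℝ} (hq0 : 0 ≤ q) (hq1 : q < 1) (hD : 0 ≤ D)
    (h : ∀ k, ‖x (k + 1) - x k‖ ^ 2 ≤ D * q ^ k) :
    ∃ l, Tendsto x atTop (𝓝 l) ∧ RLinear x l := by
  have hs : √q < 1 := by rwa [Real.sqrt_lt' one_pos, one_pow]
  have hd : ∀ k, dist (x k) (x (k + 1)) ≤ √D * √q ^ k := by
    intro k
    rw [dist_comm, dist_eq_norm]
    refine (sq_le_sq₀ (norm_nonneg _) (by positivity)).1 ((h k).trans_eq ?_)
    rw [mul_pow, Real.sq_sqrt hD, ← pow_mul, mul_comm k 2, pow_mul, Real.sq_sqrt hq0]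
  obtain ⟨l, hl⟩ := cauchySeq_tendsto_of_complete (cauchySeq_of_le_geometric _ _ hs hd)
  refine ⟨l, hl, √D / (1 - √q), √q, Real.sqrt_nonneg q, hs, fun k => ?_⟩
  rw [← dist_eq_norm]
  refine (dist_le_of_le_geometric_of_tendsto _ _ hs hd hl k).trans_eq ?_
  ring

/-! ### Linear convergence from a quadratic bound on the gap, and from the local error bound. -/

section Linear
variable {p M : ℕ} [NeZero p] [NeZero M] {L : Coef p M → ℝ} {C : Fin p → ℝ} {lam α θ Θ : ℝ}
  {x : ℕ → Coef p M} {t : ℕ → ℝ}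

/-- Linear convergence when small subgradients bound the optimality gap quadratically. -/
theorem IsProxRun.convergesLinearly (hx : IsProxRun L lam α θ Θ x t) (hlam : 0 ≤ lam)
    (hα0 : 0 ≤ α) (hα1 : α ≤ 1) (hC : BlockLipschitz L C) (hc : ConvexOn ℝ Set.univ L)
    (hL : Differentiable ℝ L) (hCpos : ∀ j, 0 < C j)
    {b : Coef p M} (hb : b ∈ minimizers (splamObj L lam α)) {A ε : ℝ} (hA : 0 < A) (hε : 0 < ε)
    (hgap : ∀ y w, splamObj L lam α y ≤ splamObj L lam α (x 0) →
      (∀ u, lam * splamPenalty α y + inner ℝ w (u - y) ≤ lam * splamPenalty α u) →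
      ‖gradient L y + w‖ ≤ ε →
      splamObj L lam α y - splamObj L lam α b ≤ A * ‖gradient L y + w‖ ^ 2) :
    ConvergesLinearly (splamObj L lam α) fun k => x (k * p) := by
  obtain ⟨K, hK, hw⟩ := hx.exists_subgradient hlam hα0 hα1 hC hc hL hCpos
  choose w hw1 hw2 hw3 using hw
  set F := splamObj L lam α with hF
  set a : ℕ → ℝ := fun k => F (x (k * p)) - F b with ha
  have hanti : Antitone a := fun k l hkl =>
    sub_le_sub_right (hx.antitone hlam hα0 hα1 (Nat.mul_le_mul_right p hkl)) _
  have ha0 : ∀ k, 0 ≤ a k := fun k => sub_nonneg.2 (hb _)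
  have hsucc : ∀ k, x ((k + 1) * p) = x (k * p + p) := fun k => by rw [Nat.succ_mul]
  have hdec : ∀ k, F (x (k * p)) - F (x (k * p + p)) = a k - a (k + 1) := fun k => by
    simp only [ha, hsucc]; ring
  have hdiff : Tendsto (fun k => K * (a k - a (k + 1))) atTop (𝓝 0) := by
    have h1 := tendsto_atTop_ciInf hanti ⟨0, by rintro _ ⟨k, rfl⟩; exact ha0 k⟩
    simpa using (h1.sub (h1.comp (tendsto_add_atTop_nat 1))).const_mul K
  -- This is the rate obtained by solving `a (k + 1) ≤ A * K * (a k - a (k + 1))` for `a (k + 1)`.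
  set q := A * K / (1 + A * K) with hq
  have hAK : 0 < A * K := mul_pos hA hK
  have hq0 : 0 < q := by positivity
  have hq1 : q < 1 := by rw [hq, div_lt_one (by positivity)]; linarith
  have hlin : ∀ᶠ k in atTop, a (k + 1) ≤ q * a k := by
    filter_upwards [hdiff.eventually_le_const (pow_pos hε 2)] with k hk
    have h2 := hw2 (k * p)
    rw [hdec] at h2
    have h3 := hgap (x (k * p + p)) (w (k * p)) (hx.antitone hlam hα0 hα1 (Nat.zero_le _))
      (hw1 _) ((sq_le_sq₀ (norm_nonneg _) hε.le).1 (h2.trans hk))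
    have h4 : a (k + 1) ≤ A * (K * (a k - a (k + 1))) := by
      refine le_trans ?_ (mul_le_mul_of_nonneg_left h2 hA.le)
      simp only [ha, hsucc]
      exact h3
    rw [hq, div_mul_eq_mul_div, le_div_iff₀ (by positivity)]
    linarith
  obtain ⟨D, hD, hDk⟩ := exists_geometric_bound hanti ha0 hq0 hq1 hlin
  have hatend : Tendsto a atTop (𝓝 0) := by
    refine squeeze_zero ha0 hDk ?_
    simpa using (tendsto_pow_atTop_nhds_zero_of_lt_one hq0.le hq1).const_mul D
  obtain ⟨l, hl, hR⟩ := rLinear_of_sq_le (x := fun k => x (k * p)) (D := K * D) hq0.le hq1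
    (by positivity) (fun k => by
      have h3 := hw3 (k * p)
      rw [hdec] at h3
      simp only [hsucc]
      refine h3.trans ?_
      rw [mul_assoc]
      exact mul_le_mul_of_nonneg_left ((sub_le_self _ (ha0 _)).trans (hDk k)) hK.le)
  -- Minimizers need not be unique: the limit `l` may differ from `b` and is recognised as a
  -- minimizer by its objective value.
  have hFl : F l = F b := by
    have h1 := ((continuous_splamObj hL lam α).tendsto l).comp hl
    have h2 := hatend.add_const (F b)
    simp only [ha, sub_add_cancel, zero_add] at h2
    exact tendsto_nhds_unique h1 h2
  refine ⟨l, fun z => hFl.trans_le (hb z), ⟨?_, q, hq0.le, hq1, ?_⟩, hR⟩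
  · have h2 := hatend.add_const (F b)
    simp only [ha, sub_add_cancel, zero_add] at h2
    rwa [hFl]
  · filter_upwards [hlin] with k hk
    rw [hFl]
    change |a (k + 1)| ≤ q * |a k|
    rwa [abs_of_nonneg (ha0 _), abs_of_nonneg (ha0 _)]

/-- The local error bound yields linear convergence. -/
theorem IsProxRun.convergesLinearly_of_localErrorBound (hx : IsProxRun L lam α θ Θ x t)
    (hlam : 0 ≤ lam) (hα0 : 0 ≤ α) (hα1 : α ≤ 1) (hC : BlockLipschitz L C)
    (hc : ConvexOn ℝ Set.univ L) (hL : Differentiable ℝ L) (hCpos : ∀ j, 0 < C j)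
    (hne : (minimizers (splamObj L lam α)).Nonempty)
    (hEB : LocalErrorBound L fun β => lam * splamPenalty α β) :
    ConvergesLinearly (splamObj L lam α) fun k => x (k * p) := by
  obtain ⟨b, hb⟩ := hne
  obtain ⟨τ, ε, hτ, hε, h⟩ := hEB (splamObj L lam α (x 0))
  refine hx.convergesLinearly hlam hα0 hα1 hC hc hL hCpos hb hτ hε fun y w hy hw hv => ?_
  -- The residual problem separates over the blocks, so its solution is the trial step with `t = 1`
  -- taken in all blocks at once.
  set r : Coef p M := WithLp.toLp 2 fun j => trialBlock L lam α y j 1 - y j with hr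
  have hrs : ∀ u, lam * splamPenalty α (y + r) + inner ℝ (-(gradient L y + r)) (u - (y + r)) ≤
      lam * splamPenalty α u := by
    refine penalty_add_inner_le fun j => ?_
    have h1 := trialBlock_isBlockSubgrad hlam hα0 hα1 L y j one_pos
    have e : (y + r) j = trialBlock L lam α y j 1 := by simp [hr]
    rw [e]
    simpa [hr, blockGrad] using h1
  have hmin : IsMinOn (fun e : Coef p M => inner ℝ (gradient L y) e + 1 / 2 * ‖e‖ ^ 2 +
      lam * splamPenalty α (y + e)) Set.univ r := by
    intro e _
    have h1 := hrs (y + e)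
    rw [add_sub_add_left_eq_sub, inner_neg_left, inner_add_left, inner_sub_right, inner_sub_right,
      real_inner_self_eq_norm_sq] at h1
    have h2 := sq_nonneg ‖e - r‖
    rw [norm_sub_sq_real, real_inner_comm] at h2
    simp only [Set.mem_ofPred_eq]
    linarith
  -- Adding the subgradient inequalities of the penalty at `y` and at `y + r` gives `‖r‖² ≤
  -- -⟪gradient L y + w, r⟫`.
  have hrv : ‖r‖ ≤ ‖gradient L y + w‖ := by
    have h1 := hrs y
    have h2 := hw (y + r)
    rw [sub_add_cancel_left, inner_neg_neg, inner_add_left, real_inner_self_eq_norm_sq] at h1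
    rw [add_sub_cancel_left] at h2
    have h3 : -inner ℝ (gradient L y + w) r ≤ ‖gradient L y + w‖ * ‖r‖ :=
      (neg_le_abs _).trans (abs_real_inner_le_norm _ _)
    rw [inner_add_left] at h3
    by_contra! hlt
    have h4 := mul_lt_mul_of_pos_right hlt ((norm_nonneg _).trans_lt hlt)
    nlinarith
  have hdist := h y r hy hmin (hrv.trans hv)
  have hgap : ∀ z ∈ minimizers (splamObj L lam α),
      splamObj L lam α y - splamObj L lam α b ≤ ‖gradient L y + w‖ * dist y z := by
    intro z hz
    have h1 := splamObj_add_inner_le hc hL hw z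
    have h2 := hz b
    have h3 : -inner ℝ (gradient L y + w) (z - y) ≤ ‖gradient L y + w‖ * ‖z - y‖ :=
      (neg_le_abs _).trans (abs_real_inner_le_norm _ _)
    rw [← dist_eq_norm, dist_comm] at h3
    linarith
  change Metric.infDist y (minimizers (splamObj L lam α)) ≤ _ at hdist
  rcases (norm_nonneg (gradient L y + w)).eq_or_lt with h0 | h0
  · have := hgap b hb
    rw [← h0] at this ⊢
    linarith
  · have h1 : (splamObj L lam α y - splamObj L lam α b) / ‖gradient L y + w‖ ≤
        Metric.infDist y (minimizers (splamObj L lam α)) := by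
      refine (Metric.le_infDist ⟨b, hb⟩).2 fun z hz => ?_
      rw [div_le_iff₀ h0, mul_comm]
      exact hgap z hz
    rw [div_le_iff₀ h0] at h1
    refine h1.trans ?_
    rw [pow_two, ← mul_assoc]
    exact mul_le_mul_of_nonneg_right
      (hdist.trans (mul_le_mul_of_nonneg_left hrv hτ.le)) h0.le

end Linear

/-! ### Hoffman's error bound for polyhedra. -/

section Hoffman
variable {V W ι : Type*} [NormedAddCommGroup V] [InnerProductSpace ℝ V] [FiniteDimensional ℝ V]
  [NormedAddCommGroup W] [NormedSpace ℝ W] [Fintype ι]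

omit [Fintype ι] in
/-- A vector in the polar of the cone `{T e = 0, a_i e ≤ 0}` is bounded by its residual. -/
theorem exists_polar_bound (T : V →ₗ[ℝ] W) (a : ι → V →ₗ[ℝ] ℝ) (J : Finset ι) :
    ∃ c : ℝ, 0 ≤ c ∧ ∀ d : V,
      (∀ e, T e = 0 → (∀ i ∈ J, a i e ≤ 0) → inner ℝ d e ≤ 0) →
      ‖d‖ ≤ c * (‖T d‖ + ∑ i ∈ J, max (a i d) 0) := by
  set P : Set V := {d | ∀ e, T e = 0 → (∀ i ∈ J, a i e ≤ 0) → inner ℝ d e ≤ 0} with hP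
  set m : V → ℝ := fun d => ‖T d‖ + ∑ i ∈ J, max (a i d) 0 with hm
  have hPc : IsClosed P := by
    simp only [hP, Set.ofPred_forall]
    exact isClosed_iInter fun e => isClosed_iInter fun _ => isClosed_iInter fun _ =>
      isClosed_le (by fun_prop) continuous_const
  have hmc : Continuous m := by
    refine T.continuous_of_finiteDimensional.norm.add (continuous_finsetSum _ fun i _ => ?_)
    exact (a i).continuous_of_finiteDimensional.max continuous_const
  -- If `m d = 0`, then `d` lies in the cone and also in its polar, so `⟪d, d⟫ ≤ 0`. By compactness
  -- `m` has a positive lower bound on the unit vectors of `P`, and positive homogeneity extends it.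
  have hmpos : ∀ d ∈ Metric.sphere (0 : V) 1 ∩ P, 0 < m d := by
    rintro d ⟨hd1, hdP⟩
    have hs : 0 ≤ ∑ i ∈ J, max (a i d) 0 := Finset.sum_nonneg fun i _ => le_max_right _ _
    by_contra! h
    have hT : T d = 0 := norm_le_zero_iff.1 (by simp only [hm] at h; linarith)
    have hS : ∑ i ∈ J, max (a i d) 0 = 0 := by
      have := norm_nonneg (T d)
      simp only [hm] at h
      linarith
    have hi := (Finset.sum_eq_zero_iff_of_nonneg fun i _ => le_max_right _ _).1 hS
    have h0 := hdP d hT fun i hiJ => (le_max_left _ _).trans (hi i hiJ).le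
    rw [real_inner_self_eq_norm_sq, mem_sphere_zero_iff_norm.1 hd1] at h0
    norm_num at h0
  obtain ⟨μ, hμ, hμm⟩ := ((isCompact_sphere (0 : V) 1).inter_right hPc).exists_forall_le'
    hmc.continuousOn hmpos
  refine ⟨1 / μ, by positivity, fun d hd => ?_⟩
  rcases eq_or_ne d 0 with rfl | hd0
  · simp
  · have hn : 0 < ‖d‖ := norm_pos_iff.2 hd0
    have h1 := hμm (‖d‖⁻¹ • d) ⟨by simp [norm_smul, hn.ne'], fun e he1 he2 => by
      rw [inner_smul_left]
      exact mul_nonpos_of_nonneg_of_nonpos (by simp) (hd e he1 he2)⟩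
    have h2 : m (‖d‖⁻¹ • d) = ‖d‖⁻¹ * m d := by
      simp only [hm, map_smul, norm_smul, norm_inv, norm_norm, mul_add, Finset.mul_sum, smul_eq_mul]
      congr 1
      refine Finset.sum_congr rfl fun i _ => ?_
      rw [mul_max_of_nonneg _ _ (by positivity), mul_zero]
    rw [h2, inv_mul_eq_div, le_div_iff₀ hn] at h1
    rw [one_div_mul_eq_div, le_div_iff₀ hμ, mul_comm]
    exact h1

/-- Hoffman's bound for the polyhedron `{z | T z = T b, a_i z ≤ 0}`. -/
theorem exists_hoffman_bound (T : V →ₗ[ℝ] W) (a : ι → V →ₗ[ℝ] ℝ) {b : V}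
    (hb : ∀ i, a i b ≤ 0) :
    ∃ c : ℝ, 0 ≤ c ∧ ∀ x, ∃ z, T z = T b ∧ (∀ i, a i z ≤ 0) ∧
      ‖x - z‖ ≤ c * (‖T (x - b)‖ + ∑ i, max (a i x) 0) := by
  classical
  choose c hc0 hc using exists_polar_bound T a
  -- The set of constraints active at the projection depends on `x`; summing over all finitely many
  -- index sets makes the constant uniform.
  refine ⟨∑ J, c J, Finset.sum_nonneg fun J _ => hc0 J, fun x => ?_⟩
  set P : Set V := {z | T z = T b ∧ ∀ i, a i z ≤ 0} with hP
  have hPc : IsClosed P := by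
    have e : P = {z | T z = T b} ∩ ⋂ i, {z | a i z ≤ 0} := by ext z; simp [hP]
    rw [e]
    exact (isClosed_eq T.continuous_of_finiteDimensional continuous_const).inter
      (isClosed_iInter fun i => isClosed_le (a i).continuous_of_finiteDimensional continuous_const)
  have hPconv : Convex ℝ P := by
    rintro u ⟨hu1, hu2⟩ v ⟨hv1, hv2⟩ s t hs ht hst
    refine ⟨?_, fun i => ?_⟩
    · rw [map_add, map_smul, map_smul, hu1, hv1, ← add_smul, hst, one_smul]
    · rw [map_add, map_smul, map_smul, smul_eq_mul, smul_eq_mul]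
      exact add_nonpos (mul_nonpos_of_nonneg_of_nonpos hs (hu2 i))
        (mul_nonpos_of_nonneg_of_nonpos ht (hv2 i))
  obtain ⟨z, hz, hzmin⟩ := exists_norm_eq_iInf_of_complete_convex (⟨b, rfl, hb⟩ : P.Nonempty)
    hPc.isComplete
    hPconv x
  have hvar := (norm_eq_iInf_iff_real_inner_le_zero hPconv hz).1 hzmin
  refine ⟨z, hz.1, hz.2, ?_⟩
  set J : Finset ι := Finset.univ.filter fun i => a i z = 0 with hJ
  have hJz : ∀ i ∈ J, a i z = 0 := fun i hi => (Finset.mem_filter.1 hi).2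
  -- A direction `e` in the cone of the active constraints stays feasible for small steps, because
  -- the inactive ones are strict at `z`. The variational inequality of the projection then puts `x
  -- - z` in the polar.
  have h := hc J (x - z) fun e he1 he2 => by
    have hev : ∀ᶠ ε : ℝ in 𝓝[>] 0, ∀ i, a i (z + ε • e) ≤ 0 := by
      rw [eventually_all]
      intro i
      by_cases hi : a i z = 0
      · filter_upwards [self_mem_nhdsWithin] with ε hε
        rw [map_add, map_smul, hi, zero_add, smul_eq_mul]
        exact mul_nonpos_of_nonneg_of_nonpos (le_of_lt hε)
          (he2 i (Finset.mem_filter.2 ⟨Finset.mem_univ i, hi⟩))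
      · have hlt : a i z < 0 := lt_of_le_of_ne (hz.2 i) hi
        have hcont : Continuous fun ε : ℝ => a i (z + ε • e) :=
          (a i).continuous_of_finiteDimensional.comp (by fun_prop)
        have := (hcont.tendsto 0).eventually_lt_const (by simpa using hlt)
        exact (this.filter_mono nhdsWithin_le_nhds).mono fun ε => le_of_lt
    obtain ⟨ε, hε, hε0⟩ := (hev.and self_mem_nhdsWithin).exists
    have h1 := hvar (z + ε • e) ⟨by rw [map_add, map_smul, he1, smul_zero, add_zero, hz.1], hε⟩
    rw [add_sub_cancel_left, inner_smul_right] at h1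
    exact nonpos_of_mul_nonpos_right h1 hε0
  have hT : T (x - z) = T (x - b) := by rw [map_sub, map_sub, hz.1]
  have hs : ∑ i ∈ J, max (a i (x - z)) 0 ≤ ∑ i, max (a i x) 0 := by
    refine (Finset.sum_le_sum_of_subset_of_nonneg (Finset.subset_univ J)
      fun i _ _ => le_max_right _ _).trans' (Finset.sum_le_sum fun i hi => ?_)
    rw [map_sub, hJz i hi, sub_zero]
  rw [hT] at h
  have hcJ : c J ≤ ∑ J, c J :=
    Finset.single_le_sum (f := c) (fun J _ => hc0 J) (Finset.mem_univ J)
  have hnn : 0 ≤ ∑ i, max (a i x) 0 := Finset.sum_nonneg fun i _ => le_max_right _ _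
  refine h.trans (mul_le_mul hcJ (add_le_add le_rfl hs) ?_ ((hc0 J).trans hcJ))
  exact add_nonneg (norm_nonneg _) (Finset.sum_nonneg fun i _ => le_max_right _ _)

end Hoffman

/-! ### The deficit `ρ ‖b‖ - ⟪γ, b⟫` of a norm controls linear residuals. -/

section Ray
variable {E : Type*} [NormedAddCommGroup E] [InnerProductSpace ℝ E]

/-- For `‖γ‖ ≤ ρ`, the kernel of `b ↦ ρ² b - ⟪γ, b⟫ γ` together with `0 ≤ ⟪γ, b⟫` describes the
zero set of `ρ ‖b‖ - ⟪γ, b⟫`. -/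
def rayMap (ρ : ℝ) (γ : E) : E →ₗ[ℝ] E :=
  ρ ^ 2 • LinearMap.id - (innerₗ E γ).smulRight γ

theorem rayMap_apply (ρ : ℝ) (γ b : E) : rayMap ρ γ b = ρ ^ 2 • b - inner ℝ γ b • γ := rfl

theorem abs_inner_le_of_norm_le {ρ : ℝ} {γ : E} (hγ : ‖γ‖ ≤ ρ) (b : E) :
    |inner ℝ γ b| ≤ ρ * ‖b‖ :=
  (abs_real_inner_le_norm γ b).trans (mul_le_mul_of_nonneg_right hγ (norm_nonneg b))

/-- Since `‖γ‖ ≤ ρ`, expanding the square bounds it by `ρ² (ρ² ‖b‖² - ⟪γ, b⟫²)`. This factors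
through the deficit, and the other factor `ρ ‖b‖ + ⟪γ, b⟫` is at most `2ζ`. -/
theorem norm_rayMap_sq_le {ρ ζ : ℝ} {γ b : E} (hγ : ‖γ‖ ≤ ρ) (hb : ρ * ‖b‖ ≤ ζ) :
    ‖rayMap ρ γ b‖ ^ 2 ≤ 2 * ρ ^ 2 * ζ * (ρ * ‖b‖ - inner ℝ γ b) := by
  have h1 := abs_le.1 (abs_inner_le_of_norm_le hγ b)
  have h2 : ‖γ‖ ^ 2 ≤ ρ ^ 2 := pow_le_pow_left₀ (norm_nonneg γ) hγ 2
  rw [rayMap_apply, norm_sub_sq_real, inner_smul_left, inner_smul_right, norm_smul, norm_smul,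
    mul_pow, mul_pow, real_inner_comm γ b, Real.norm_eq_abs, Real.norm_eq_abs, sq_abs, sq_abs,
    conj_trivial]
  have h3 := mul_le_mul_of_nonneg_left h2 (sq_nonneg (inner ℝ γ b))
  have h4 : ρ ^ 2 * ((ρ * ‖b‖ - inner ℝ γ b) * (ρ * ‖b‖ + inner ℝ γ b)) ≤
      ρ ^ 2 * ((ρ * ‖b‖ - inner ℝ γ b) * (2 * ζ)) := by
    refine mul_le_mul_of_nonneg_left (mul_le_mul_of_nonneg_left ?_ ?_) (sq_nonneg ρ) <;> linarith
  linarith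

theorem max_neg_inner_sq_le {ρ ζ : ℝ} {γ b : E} (hγ : ‖γ‖ ≤ ρ) (hb : ρ * ‖b‖ ≤ ζ) :
    max (-inner ℝ γ b) 0 ^ 2 ≤ ζ * (ρ * ‖b‖ - inner ℝ γ b) := by
  have h1 := abs_le.1 (abs_inner_le_of_norm_le hγ b)
  have h0 : 0 ≤ ρ * ‖b‖ := mul_nonneg ((norm_nonneg γ).trans hγ) (norm_nonneg b)
  rcases le_total (-inner ℝ γ b) 0 with h | h
  · rw [max_eq_right h, zero_pow two_ne_zero]
    exact mul_nonneg (h0.trans hb) (by linarith)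
  · rw [max_eq_left h, pow_two]
    exact mul_le_mul (by linarith) (by linarith) h (h0.trans hb)

theorem eq_inner_of_rayMap_eq_zero {ρ : ℝ} {γ b : E} (hρ : 0 ≤ ρ) (h : rayMap ρ γ b = 0)
    (hb : 0 ≤ inner ℝ γ b) : ρ * ‖b‖ = inner ℝ γ b := by
  have h1 : inner ℝ b (rayMap ρ γ b) = 0 := by rw [h, inner_zero_right]
  rw [rayMap_apply, inner_sub_right, inner_smul_right, inner_smul_right,
    real_inner_self_eq_norm_sq, real_inner_comm γ b] at h1
  refine (sq_eq_sq₀ (mul_nonneg hρ (norm_nonneg b)) hb).1 ?_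
  linarith

end Ray

/-! ### Quadratic growth of one-dimensional Bregman divergences. -/

section Growth

/-- A loss `ψ` on the line with derivative `ψ'` whose Bregman divergence grows quadratically on
sublevel sets. -/
def BregmanGrowth (ψ ψ' : ℝ → ℝ) : Prop :=
  ∀ s₀ ζ : ℝ, ∃ κ > 0, ∀ s, 0 ≤ ψ s - ψ s₀ - ψ' s₀ * (s - s₀) ∧
    (ψ s - ψ s₀ - ψ' s₀ * (s - s₀) ≤ ζ →
      κ * (s - s₀) ^ 2 ≤ ψ s - ψ s₀ - ψ' s₀ * (s - s₀))

theorem ConvexOn.add_mul_le_of_hasDerivAt {S : Set ℝ} {f : ℝ → ℝ} {f' a s : ℝ}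
    (hf : ConvexOn ℝ S f) (ha : a ∈ S) (hs : s ∈ S) (hd : HasDerivAt f f' a) :
    f a + f' * (s - a) ≤ f s := by
  rcases lt_trichotomy a s with h | rfl | h
  · have := hf.le_slope_of_hasDerivAt ha hs h hd
    rw [slope_def_field, le_div_iff₀ (sub_pos.2 h)] at this
    linarith
  · simp
  · have := hf.slope_le_of_hasDerivAt hs ha h hd
    rw [slope_def_field, div_le_iff₀ (sub_pos.2 h)] at this
    linarith

/-- Within distance `1` of `s₀`, compactness bounds `ψ''` below by some `m > 0`. Farther away,
convexity makes the divergence grow at least linearly, and a divergence of at most `ζ` bounds the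
distance, so the linear bound is also a quadratic one. -/
theorem bregmanGrowth_of_pos_deriv2 {ψ ψ' ψ'' : ℝ → ℝ} (h1 : ∀ s, HasDerivAt ψ (ψ' s) s)
    (h2 : ∀ s, HasDerivAt ψ' (ψ'' s) s) (hc : Continuous ψ'') (hpos : ∀ s, 0 < ψ'' s) :
    BregmanGrowth ψ ψ' := by
  intro s₀ ζ
  have hd1 : deriv ψ = ψ' := funext fun s => (h1 s).deriv
  have hconv : ConvexOn ℝ Set.univ ψ := by
    refine convexOn_univ_of_deriv2_nonneg (fun s => (h1 s).differentiableAt)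
      (by rw [hd1]; exact fun s => (h2 s).differentiableAt) fun s => ?_
    simp only [Function.iterate_succ, Function.iterate_zero, Function.comp_apply, id_eq, hd1,
      (h2 s).deriv]
    exact (hpos s).le
  obtain ⟨m, hm, hmle⟩ := (isCompact_Icc (a := s₀ - 1) (b := s₀ + 1)).exists_forall_le'
    hc.continuousOn fun s _ => hpos s
  have hnear : ∀ s ∈ Set.Icc (s₀ - 1) (s₀ + 1),
      m / 2 * (s - s₀) ^ 2 ≤ ψ s - ψ s₀ - ψ' s₀ * (s - s₀) := by
    intro s hs
    have hg1 : ∀ s, HasDerivAt (fun s => ψ s - m / 2 * (s - s₀) ^ 2) (ψ' s - m * (s - s₀)) s := by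
      intro s
      refine ((h1 s).sub
        ((((hasDerivAt_id s).sub_const s₀).pow 2).const_mul (m / 2))).congr_deriv ?_
      simp
      ring
    have hg2 : ∀ s, HasDerivAt (fun s => ψ' s - m * (s - s₀)) (ψ'' s - m) s := by
      intro s
      refine ((h2 s).sub (((hasDerivAt_id s).sub_const s₀).const_mul m)).congr_deriv ?_
      simp
    have hmono : MonotoneOn (fun s => ψ' s - m * (s - s₀)) (Set.Icc (s₀ - 1) (s₀ + 1)) := by
      refine monotoneOn_of_deriv_nonneg (convex_Icc _ _)
        (fun s _ => (hg2 s).continuousAt.continuousWithinAt)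
        (fun s _ => (hg2 s).differentiableAt.differentiableWithinAt) fun s hs => ?_
      rw [(hg2 s).deriv]
      exact sub_nonneg.2 (hmle s (interior_subset hs))
    have hgc : ConvexOn ℝ (Set.Icc (s₀ - 1) (s₀ + 1)) fun s => ψ s - m / 2 * (s - s₀) ^ 2 := by
      refine MonotoneOn.convexOn_of_deriv (convex_Icc _ _)
        (fun s _ => (hg1 s).continuousAt.continuousWithinAt)
        (fun s _ => (hg1 s).differentiableAt.differentiableWithinAt) ?_
      rw [funext fun s => (hg1 s).deriv]
      exact hmono.mono interior_subset
    have := hgc.add_mul_le_of_hasDerivAt (a := s₀) ⟨by linarith, by linarith⟩ hs (hg1 s₀)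
    simp only [sub_self, mul_zero, sub_zero, ne_eq, OfNat.ofNat_ne_zero, not_false_eq_true,
      zero_pow] at this
    linarith
  -- The denominator dominates both `1`, for the near case, and `|s - s₀| ≤ 2 |ζ| / m`, for the far
  -- case.
  refine ⟨m / 2 / (1 + 2 * |ζ| / m), by positivity, fun s => ⟨?_, fun hζ => ?_⟩⟩
  · have := hconv.add_mul_le_of_hasDerivAt (Set.mem_univ s₀) (Set.mem_univ s) (h1 s₀)
    linarith
  set δ := s - s₀ with hδ
  have hden : 1 ≤ 1 + 2 * |ζ| / m := by
    have : 0 ≤ 2 * |ζ| / m := by positivity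
    linarith
  rcases le_or_gt |δ| 1 with hle | hgt
  · have h3 := abs_le.1 hle
    refine le_trans ?_ (hnear s ⟨by linarith, by linarith⟩)
    exact mul_le_mul_of_nonneg_right (div_le_self (by positivity) hden) (sq_nonneg _)
  · have h0 : 0 < |δ| := one_pos.trans hgt
    have hw : abs (δ / |δ|) = 1 := by rw [abs_div, abs_abs, div_self h0.ne']
    have hw2 := abs_le.1 hw.le
    have h3 := hnear (s₀ + δ / |δ|) ⟨by linarith, by linarith⟩
    rw [add_sub_cancel_left, ← sq_abs, hw, one_pow, mul_one] at h3
    have h4 := hconv.2 (Set.mem_univ s₀) (Set.mem_univ s)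
      (show 0 ≤ 1 - 1 / |δ| by rw [sub_nonneg, div_le_one h0]; exact hgt.le)
      (show 0 ≤ 1 / |δ| by positivity) (sub_add_cancel 1 _)
    have e : (1 - 1 / |δ|) • s₀ + (1 / |δ|) • s = s₀ + δ / |δ| := by
      simp only [smul_eq_mul, hδ]; ring
    rw [e, smul_eq_mul, smul_eq_mul] at h4
    have h5 : m / 2 ≤ 1 / |δ| * (ψ s - ψ s₀ - ψ' s₀ * δ) := by
      have e2 : ψ' s₀ * (δ / |δ|) = 1 / |δ| * (ψ' s₀ * δ) := by ring
      rw [e2] at h3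
      linarith
    rw [one_div_mul_eq_div, le_div_iff₀ h0] at h5
    refine le_trans ?_ h5
    have h6 : |δ| ≤ 1 + 2 * |ζ| / m := by
      have h7 : m / 2 * |δ| ≤ |ζ| := h5.trans (hζ.trans (le_abs_self ζ))
      have h8 : |δ| ≤ 2 * |ζ| / m := by
        rw [le_div_iff₀ hm]; linarith
      linarith
    rw [div_mul_eq_mul_div, div_le_iff₀ (by positivity), mul_assoc]
    refine mul_le_mul_of_nonneg_left ?_ (by positivity)
    rw [← sq_abs, pow_two]
    exact mul_le_mul_of_nonneg_left h6 h0.le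

end Growth

/-! ### Quadratic growth of the objective for separable losses. -/

/-- The values of the linear predictors and of the arguments of the norms. -/
abbrev SplitSpace (N p M : ℕ) : Type :=
  (Fin N → ℝ) × (Fin p → EuclideanSpace ℝ (Fin M)) × (Fin p → EuclideanSpace ℝ (Fin M))

section Separable
variable {p M N : ℕ} [NeZero M] {L : Coef p M → ℝ} {C : Fin p → ℝ} {lam α : ℝ}
  {l : Fin N → Coef p M →ₗ[ℝ] ℝ} {ψ ψ' : Fin N → ℝ → ℝ}

omit [NeZero M] in
theorem inner_gradient_separable (hψ : ∀ i s, HasDerivAt (ψ i) (ψ' i s) s)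
    (hL : Differentiable ℝ L) (hLψ : ∀ β, L β = ∑ i, ψ i (l i β)) (b d : Coef p M) :
    inner ℝ (gradient L b) d = ∑ i, ψ' i (l i b) * l i d := by
  have h1 := hasDerivAt_line hL b d 0
  have h2 : HasDerivAt (fun s : ℝ => L (b + s • d)) (∑ i, ψ' i (l i b) * l i d) 0 := by
    simp only [hLψ]
    refine HasDerivAt.fun_sum fun i _ => ?_
    have h3 : HasDerivAt (fun s : ℝ => l i (b + s • d)) (l i d) 0 := by
      simp only [map_add, map_smul, smul_eq_mul]
      simpa using ((hasDerivAt_id (0 : ℝ)).mul_const (l i d)).const_add (l i b)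
    have h4 : HasDerivAt (ψ i) (ψ' i (l i b)) (l i (b + (0 : ℝ) • d)) := by
      simpa using hψ i (l i b)
    exact h4.comp (0 : ℝ) h3
  simpa using h1.unique h2

/-- The optimality gap splits into Bregman divergences of the losses and of the norms. -/
theorem splamObj_sub_eq (hψ : ∀ i s, HasDerivAt (ψ i) (ψ' i s) s) (hL : Differentiable ℝ L)
    (hLψ : ∀ β, L β = ∑ i, ψ i (l i β)) {b : Coef p M}
    {γ₁ γ₂ : Fin p → EuclideanSpace ℝ (Fin M)} (hγ : ∀ j, -(gradient L b j) = γ₁ j + γ₂ j)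
    (hn : ∀ j, nonlin (γ₂ j) = γ₂ j) (h1 : ∀ j, inner ℝ (γ₁ j) (b j) = lam * α * ‖b j‖)
    (h2 : ∀ j, inner ℝ (γ₂ j) (b j) = lam * (1 - α) * ‖nonlin (b j)‖) (y : Coef p M) :
    splamObj L lam α y - splamObj L lam α b =
      (∑ i, (ψ i (l i y) - ψ i (l i b) - ψ' i (l i b) * (l i y - l i b))) +
      ∑ j, ((lam * α * ‖y j‖ - inner ℝ (γ₁ j) (y j)) +
        (lam * (1 - α) * ‖nonlin (y j)‖ - inner ℝ (γ₂ j) (nonlin (y j)))) := by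
  have hg := inner_gradient_separable hψ hL hLψ b (y - b)
  have hg2 : inner ℝ (gradient L b) (y - b) =
      ∑ j, (inner ℝ (γ₁ j) (b j) + inner ℝ (γ₂ j) (b j) -
        (inner ℝ (γ₁ j) (y j) + inner ℝ (γ₂ j) (y j))) := by
    rw [PiLp.inner_apply]
    refine Finset.sum_congr rfl fun j _ => ?_
    rw [← neg_neg (gradient L b j), hγ, inner_neg_left, PiLp.sub_apply, inner_sub_right,
      inner_add_left, inner_add_left, neg_sub]
  unfold splamObj
  rw [lam_mul_splamPenalty, lam_mul_splamPenalty, hLψ, hLψ]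
  simp only [inner_nonlin_right, hn]
  have e1 : ∑ i, (ψ i (l i y) - ψ i (l i b) - ψ' i (l i b) * (l i y - l i b)) =
      ∑ i, ψ i (l i y) - ∑ i, ψ i (l i b) - inner ℝ (gradient L b) (y - b) := by
    rw [hg, Finset.sum_sub_distrib, Finset.sum_sub_distrib]
    simp only [map_sub]
  have e2 : ∑ j, (lam * α * ‖y j‖ + lam * (1 - α) * ‖nonlin (y j)‖) -
      ∑ j, (lam * α * ‖b j‖ + lam * (1 - α) * ‖nonlin (b j)‖) =
      ∑ j, ((lam * α * ‖y j‖ - inner ℝ (γ₁ j) (y j)) +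
        (lam * (1 - α) * ‖nonlin (y j)‖ - inner ℝ (γ₂ j) (y j))) -
      inner ℝ (gradient L b) (y - b) := by
    rw [hg2, ← Finset.sum_sub_distrib, ← Finset.sum_sub_distrib]
    refine Finset.sum_congr rfl fun j _ => ?_
    rw [h1, h2]
    ring
  linarith

set_option maxHeartbeats 1000000 in
/-- Quadratic growth of the objective, for a loss that is a sum of nonnegative losses of linear
functionals. -/
theorem exists_quadratic_growth (hψ : ∀ i s, HasDerivAt (ψ i) (ψ' i s) s)
    (hψ0 : ∀ i s, 0 ≤ ψ i s) (hgrow : ∀ i, BregmanGrowth (ψ i) (ψ' i)) (hL : Differentiable ℝ L)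
    (hLψ : ∀ β, L β = ∑ i, ψ i (l i β)) (hlam : 0 ≤ lam) (hα0 : 0 ≤ α) (hα1 : α ≤ 1)
    (hC : BlockLipschitz L C) (hCpos : ∀ j, 0 < C j) {b : Coef p M}
    (hb : b ∈ minimizers (splamObj L lam α)) (ζ : ℝ) :
    ∃ κ > 0, ∀ y, splamObj L lam α y ≤ ζ → ∃ z ∈ minimizers (splamObj L lam α),
      ‖y - z‖ ^ 2 ≤ κ * (splamObj L lam α y - splamObj L lam α b) := by
  have hsub := isBlockSubgrad_of_mem_minimizers hlam hα0 hα1 hC hL hCpos hb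
  choose γ₁ γ₂ hγ hγ₁ hγ₂ hn h1 h2 using hsub
  have hsplit := splamObj_sub_eq hψ hL hLψ hγ hn h1 h2
  set ρ₁ := lam * α with hρ₁
  set ρ₂ := lam * (1 - α) with hρ₂
  have hρ₁0 : 0 ≤ ρ₁ := mul_nonneg hlam hα0
  have hρ₂0 : 0 ≤ ρ₂ := mul_nonneg hlam (sub_nonneg.2 hα1)
  set F := splamObj L lam α with hF
  -- The polyhedron `T z = T b`, `a i z ≤ 0` consists of minimizers: equal predictors kill the loss
  -- divergences, and the ray equations with the signs from `a` kill the deficits of the norms.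
  set T : Coef p M →ₗ[ℝ] SplitSpace N p M :=
    (LinearMap.pi fun i => l i).prod
      ((LinearMap.pi fun j => rayMap ρ₁ (γ₁ j) ∘ₗ (PiLp.projₗ 2 _ j)).prod
        (LinearMap.pi fun j => rayMap ρ₂ (γ₂ j) ∘ₗ nonlinLin ∘ₗ (PiLp.projₗ 2 _ j))) with hT
  set a : Fin p ⊕ Fin p → Coef p M →ₗ[ℝ] ℝ := Sum.elim
    (fun j => -(innerₗ _ (γ₁ j)) ∘ₗ (PiLp.projₗ 2 _ j))
    (fun j => -(innerₗ _ (γ₂ j)) ∘ₗ nonlinLin ∘ₗ (PiLp.projₗ 2 _ j)) with ha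
  have ha1 : ∀ j y, a (Sum.inl j) y = -inner ℝ (γ₁ j) (y j) := fun _ _ => rfl
  have ha2 : ∀ j y, a (Sum.inr j) y = -inner ℝ (γ₂ j) (nonlin (y j)) := fun _ _ => rfl
  have h2' : ∀ j, inner ℝ (γ₂ j) (nonlin (b j)) = ρ₂ * ‖nonlin (b j)‖ := fun j => by
    rw [inner_nonlin_right, hn, h2]
  have hab : ∀ i, a i b ≤ 0 := by
    rintro (j | j)
    · rw [ha1, h1]
      exact neg_nonpos.2 (by positivity)
    · rw [ha2, h2']
      exact neg_nonpos.2 (by positivity)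
  have hr1 : ∀ j, rayMap ρ₁ (γ₁ j) (b j) = 0 := fun j => by
    have := norm_rayMap_sq_le (hγ₁ j) (le_refl (ρ₁ * ‖b j‖))
    rw [h1, sub_self, mul_zero] at this
    simpa using this
  have hr2 : ∀ j, rayMap ρ₂ (γ₂ j) (nonlin (b j)) = 0 := fun j => by
    have := norm_rayMap_sq_le (hγ₂ j) (le_refl (ρ₂ * ‖nonlin (b j)‖))
    rw [h2', sub_self, mul_zero] at this
    simpa using this
  have hT0 : ∀ y, T (y - b) = (fun i => l i y - l i b, fun j => rayMap ρ₁ (γ₁ j) (y j),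
      fun j => rayMap ρ₂ (γ₂ j) (nonlin (y j))) := fun y => by
    simp only [hT, LinearMap.prod_apply, Function.prod_apply, Prod.mk.injEq]
    refine ⟨?_, ?_, ?_⟩ <;> ext1 j
    · exact map_sub (l j) y b
    · change rayMap ρ₁ (γ₁ j) (y j - b j) = _
      rw [map_sub, hr1, sub_zero]
    · change rayMap ρ₂ (γ₂ j) (nonlin (y j - b j)) = _
      rw [nonlin_sub, map_sub, hr2, sub_zero]
  obtain ⟨c, hc, hhoff⟩ := exists_hoffman_bound T a hab
  choose κ hκ hκD using fun i => hgrow i (l i b) (ζ - F b)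
  set K := (∑ i, 1 / κ i) + 2 * ρ₁ ^ 2 * |ζ| + 2 * ρ₂ ^ 2 * |ζ| + |ζ| with hK
  have hKsum : 0 ≤ ∑ i, 1 / κ i := Finset.sum_nonneg fun i _ => (one_div_pos.2 (hκ i)).le
  have hK1 : 0 ≤ 2 * ρ₁ ^ 2 * |ζ| := by positivity
  have hK2 : 0 ≤ 2 * ρ₂ ^ 2 * |ζ| := by positivity
  have hK0 : 0 ≤ K := by positivity
  refine ⟨(c * (1 + ∑ _i : Fin p ⊕ Fin p, 1)) ^ 2 * K + 1, by positivity, fun y hy => ?_⟩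
  obtain ⟨z, hzT, hza, hz⟩ := hhoff y
  set Δ := F y - F b with hΔ
  have hΔ0 : 0 ≤ Δ := sub_nonneg.2 (hb y)
  have hq1 : ∀ j (u : Coef p M), 0 ≤ ρ₁ * ‖u j‖ - inner ℝ (γ₁ j) (u j) := fun j u =>
    sub_nonneg.2 ((le_abs_self _).trans (abs_inner_le_of_norm_le (hγ₁ j) _))
  have hq2 : ∀ j (u : Coef p M), 0 ≤ ρ₂ * ‖nonlin (u j)‖ - inner ℝ (γ₂ j) (nonlin (u j)) :=
    fun j u => sub_nonneg.2 ((le_abs_self _).trans (abs_inner_le_of_norm_le (hγ₂ j) _))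
  have hD0 : ∀ i, 0 ≤ ψ i (l i y) - ψ i (l i b) - ψ' i (l i b) * (l i y - l i b) :=
    fun i => (hκD i _).1
  have hsy := hsplit y
  rw [← hΔ] at hsy
  have hS1 := Finset.sum_nonneg fun i (_ : i ∈ Finset.univ) => hD0 i
  have hS2 := Finset.sum_nonneg fun j (_ : j ∈ Finset.univ) => add_nonneg (hq1 j y) (hq2 j y)
  have hDΔ : ∀ i, ψ i (l i y) - ψ i (l i b) - ψ' i (l i b) * (l i y - l i b) ≤ Δ := fun i => by
    have := Finset.single_le_sum (fun i (_ : i ∈ Finset.univ) => hD0 i) (Finset.mem_univ i)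
    linarith
  have hqΔ : ∀ j, (ρ₁ * ‖y j‖ - inner ℝ (γ₁ j) (y j)) +
      (ρ₂ * ‖nonlin (y j)‖ - inner ℝ (γ₂ j) (nonlin (y j))) ≤ Δ := fun j => by
    have := Finset.single_le_sum
      (fun j (_ : j ∈ Finset.univ) => add_nonneg (hq1 j y) (hq2 j y)) (Finset.mem_univ j)
    linarith
  -- Nonnegativity of the losses lets the sublevel bound on the objective control each norm term,
  -- even when the sublevel set is unbounded.
  have hpen : ∀ j, ρ₁ * ‖y j‖ + ρ₂ * ‖nonlin (y j)‖ ≤ |ζ| := fun j => by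
    have e1 := Finset.single_le_sum (f := fun j => ρ₁ * ‖y j‖ + ρ₂ * ‖nonlin (y j)‖)
      (fun j (_ : j ∈ Finset.univ) => by positivity) (Finset.mem_univ j)
    have e2 : 0 ≤ L y := by
      rw [hLψ]
      exact Finset.sum_nonneg fun i _ => hψ0 i _
    have e3 := lam_mul_splamPenalty lam α y
    have e4 : L y + lam * splamPenalty α y ≤ |ζ| := hy.trans (le_abs_self ζ)
    simp only at e1
    linarith
  have hp1 : ∀ j, ρ₁ * ‖y j‖ ≤ |ζ| := fun j => by
    have : 0 ≤ ρ₂ * ‖nonlin (y j)‖ := by positivity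
    linarith [hpen j]
  have hp2 : ∀ j, ρ₂ * ‖nonlin (y j)‖ ≤ |ζ| := fun j => by
    have : 0 ≤ ρ₁ * ‖y j‖ := by positivity
    linarith [hpen j]
  have hq1Δ : ∀ j, ρ₁ * ‖y j‖ - inner ℝ (γ₁ j) (y j) ≤ Δ := fun j => by
    linarith [hqΔ j, hq2 j y]
  have hq2Δ : ∀ j, ρ₂ * ‖nonlin (y j)‖ - inner ℝ (γ₂ j) (nonlin (y j)) ≤ Δ := fun j => by
    linarith [hqΔ j, hq1 j y]
  -- Every summand of the gap is nonnegative, hence at most `Δ`, so each residual in Hoffman's bound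
  -- is at most `√(K * Δ)`.
  have key : ∀ {r k q : ℝ}, r ^ 2 ≤ k * q → q ≤ Δ → 0 ≤ k → k ≤ K → r ≤ √(K * Δ) := by
    intro r k q hr hq hk hkK
    refine Real.le_sqrt_of_sq_le (hr.trans ?_)
    exact (mul_le_mul_of_nonneg_left hq hk).trans (mul_le_mul_of_nonneg_right hkK hΔ0)
  have hTle : ‖T (y - b)‖ ≤ √(K * Δ) := by
    have hs := Real.sqrt_nonneg (K * Δ)
    rw [hT0]
    refine norm_prod_le_iff.2 ⟨(pi_norm_le_iff_of_nonneg hs).2 fun i => ?_,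
      norm_prod_le_iff.2 ⟨(pi_norm_le_iff_of_nonneg hs).2 fun j => ?_,
        (pi_norm_le_iff_of_nonneg hs).2 fun j => ?_⟩⟩
    · refine key (k := 1 / κ i) (q := Δ) ?_ le_rfl (one_div_pos.2 (hκ i)).le ?_
      · rw [Real.norm_eq_abs, sq_abs, one_div_mul_eq_div, le_div_iff₀ (hκ i), mul_comm]
        exact ((hκD i (l i y)).2 ((hDΔ i).trans (sub_le_sub_right hy _))).trans (hDΔ i)
      · have := Finset.single_le_sum (f := fun i => 1 / κ i)
          (fun i _ => (one_div_pos.2 (hκ i)).le) (Finset.mem_univ i)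
        linarith [abs_nonneg ζ]
    · exact key (norm_rayMap_sq_le (hγ₁ j) (hp1 j)) (hq1Δ j) hK1 (by linarith [abs_nonneg ζ])
    · exact key (norm_rayMap_sq_le (hγ₂ j) (hp2 j)) (hq2Δ j) hK2 (by linarith [abs_nonneg ζ])
  have hale : ∑ i, max (a i y) 0 ≤ (∑ _i : Fin p ⊕ Fin p, 1) * √(K * Δ) := by
    rw [Finset.sum_mul]
    refine Finset.sum_le_sum fun i _ => ?_
    rw [one_mul]
    rcases i with j | j
    · exact key (max_neg_inner_sq_le (hγ₁ j) (hp1 j)) (hq1Δ j) (abs_nonneg ζ) (by linarith)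
    · exact key (max_neg_inner_sq_le (hγ₂ j) (hp2 j)) (hq2Δ j) (abs_nonneg ζ) (by linarith)
  refine ⟨z, fun u => ?_, ?_⟩
  · have hz0 : T (z - b) = 0 := by
      rw [map_sub, sub_eq_zero]
      exact hzT
    rw [hT0] at hz0
    simp only [Prod.mk_eq_zero, funext_iff, Pi.zero_apply] at hz0
    have e := hsplit z
    rw [Finset.sum_eq_zero, Finset.sum_eq_zero, add_zero, sub_eq_zero] at e
    · exact e.trans_le (hb u)
    · intro j _
      have e1 := hza (Sum.inl j)
      have e2 := hza (Sum.inr j)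
      rw [ha1, neg_nonpos] at e1
      rw [ha2, neg_nonpos] at e2
      rw [eq_inner_of_rayMap_eq_zero hρ₁0 (hz0.2.1 j) e1,
        eq_inner_of_rayMap_eq_zero hρ₂0 (hz0.2.2 j) e2]
      ring
    · intro i _
      rw [hz0.1 i, sub_eq_zero.1 (hz0.1 i)]
      ring
  · have e1 : ‖y - z‖ ≤ c * (1 + ∑ _i : Fin p ⊕ Fin p, 1) * √(K * Δ) := by
      refine hz.trans ?_
      rw [mul_assoc]
      refine mul_le_mul_of_nonneg_left ?_ hc
      rw [add_mul, one_mul]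
      exact add_le_add hTle hale
    refine (pow_le_pow_left₀ (norm_nonneg _) e1 2).trans ?_
    rw [mul_pow, Real.sq_sqrt (mul_nonneg hK0 hΔ0), ← mul_assoc, add_mul, one_mul]
    linarith

end Separable

/-! ### The quadratic and logistic losses. -/

section Losses
variable {p M N : ℕ}

/-- The linear predictor as a linear functional. -/
def linPredLin (X : Matrix (Fin N) (Fin p × Fin M) ℝ) (i : Fin N) : Coef p M →ₗ[ℝ] ℝ where
  toFun := fun β => linPred X β i
  map_add' u v := by
    simp only [linPred, PiLp.add_apply, mul_add, Finset.sum_add_distrib]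
  map_smul' c u := by
    simp only [linPred, PiLp.smul_apply, smul_eq_mul, Finset.mul_sum, RingHom.id_apply]
    exact Finset.sum_congr rfl fun j _ => Finset.sum_congr rfl fun m _ => by ring

theorem hasDerivAt_quad (c y s : ℝ) :
    HasDerivAt (fun s => c * (y - s) ^ 2) (2 * c * (s - y)) s := by
  refine ((((hasDerivAt_id s).const_sub y).pow 2).const_mul c).congr_deriv ?_
  simp
  ring

theorem bregmanGrowth_quad {c : ℝ} (hc : 0 < c) (y : ℝ) :
    BregmanGrowth (fun s => c * (y - s) ^ 2) fun s => 2 * c * (s - y) := by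
  refine bregmanGrowth_of_pos_deriv2 (ψ'' := fun _ => 2 * c) (hasDerivAt_quad c y) (fun s => ?_)
    continuous_const fun _ => by positivity
  simpa using ((hasDerivAt_id s).sub_const y).const_mul (2 * c)

theorem hasDerivAt_exp_neg_mul (y s : ℝ) :
    HasDerivAt (fun s => Real.exp (-(y * s))) (-(y * Real.exp (-(y * s)))) s := by
  refine ((((hasDerivAt_id s).const_mul y).neg).exp).congr_deriv ?_
  simp [mul_comm]

theorem hasDerivAt_logistic (c y s : ℝ) :
    HasDerivAt (fun s => c * Real.log (1 + Real.exp (-(y * s))))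
      (c * (-(y * Real.exp (-(y * s))) / (1 + Real.exp (-(y * s))))) s :=
  (((hasDerivAt_exp_neg_mul y s).const_add 1).log (by positivity)).const_mul c

theorem bregmanGrowth_logistic {c y : ℝ} (hc : 0 < c) (hy : y ≠ 0) :
    BregmanGrowth (fun s => c * Real.log (1 + Real.exp (-(y * s))))
      fun s => c * (-(y * Real.exp (-(y * s))) / (1 + Real.exp (-(y * s)))) := by
  refine bregmanGrowth_of_pos_deriv2
    (ψ'' := fun s => c * (y ^ 2 * Real.exp (-(y * s)) / (1 + Real.exp (-(y * s))) ^ 2))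
    (hasDerivAt_logistic c y) (fun s => ?_) ?_ fun s => by positivity
  · have h := hasDerivAt_exp_neg_mul y s
    refine ((((h.const_mul y).neg).div (h.const_add 1) (by positivity)).const_mul c).congr_deriv ?_
    simp only [Pi.neg_apply]
    congr 2
    ring
  · have h : ∀ s, (1 + Real.exp (-(y * s))) ^ 2 ≠ 0 := fun s => by positivity
    fun_prop (disch := exact h _)

/-- The objective with the quadratic loss has a minimizer. -/
theorem minimizers_quadLoss_nonempty [NeZero M] {lam α : ℝ} (hlam : 0 ≤ lam) (hα0 : 0 ≤ α)
    (hα1 : α ≤ 1) (hN : 0 < N) (X : Matrix (Fin N) (Fin p × Fin M) ℝ) (y : Fin N → ℝ) :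
    (minimizers (splamObj (quadLoss X y) lam α)).Nonempty := by
  have hN' : (0 : ℝ) < N := by exact_mod_cast hN
  set ρ₁ := lam * α with hρ₁
  set ρ₂ := lam * (1 - α) with hρ₂
  have hρ₁0 : 0 ≤ ρ₁ := mul_nonneg hlam hα0
  have hρ₂0 : 0 ≤ ρ₂ := mul_nonneg hlam (sub_nonneg.2 hα1)
  set c := 1 / (2 * (N : ℝ)) with hc
  have hc0 : 0 < c := by positivity
  -- The objective itself need not be coercive, but it is `Φ ∘ S` with `Φ` coercive. A minimizer of
  -- `Φ` over the range of `S`, closed by finite dimension, therefore exists and lifts.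
  let S : Coef p M →ₗ[ℝ] SplitSpace N p M :=
    (LinearMap.pi fun i => linPredLin X i).prod
      ((LinearMap.pi fun j => ρ₁ • (PiLp.projₗ 2 _ j)).prod
        (LinearMap.pi fun j => ρ₂ • nonlinLin ∘ₗ (PiLp.projₗ 2 _ j)))
  let Φ : SplitSpace N p M → ℝ := fun w => c * ∑ i, (y i - w.1 i) ^ 2 + ∑ j, (‖w.2.1 j‖ + ‖w.2.2 j‖)
  have hΦc : Continuous Φ := by fun_prop
  have hFΦ : ∀ β, splamObj (quadLoss X y) lam α β = Φ (S β) := fun β => by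
    simp only [splamObj, quadLoss, lam_mul_splamPenalty]
    refine congrArg₂ (· + ·) rfl (Finset.sum_congr rfl fun j _ => ?_)
    change _ = ‖ρ₁ • β j‖ + ‖ρ₂ • nonlin (β j)‖
    rw [norm_smul, norm_smul, Real.norm_of_nonneg hρ₁0, Real.norm_of_nonneg hρ₂0]
  have hbdd : Bornology.IsBounded {w | Φ w ≤ Φ 0} := by
    refine isBounded_iff_forall_norm_le.2 ⟨∑ i, |y i| + √(Φ 0 / c) + Φ 0, fun w hw => ?_⟩
    have hw' : Φ w ≤ Φ 0 := hw
    have h1 : 0 ≤ c * ∑ i, (y i - w.1 i) ^ 2 := by positivity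
    have h2 : 0 ≤ ∑ j, (‖w.2.1 j‖ + ‖w.2.2 j‖) := by positivity
    have h3 : c * ∑ i, (y i - w.1 i) ^ 2 ≤ Φ 0 := by simp only [Φ] at hw' ⊢; linarith
    have h4 : ∑ j, (‖w.2.1 j‖ + ‖w.2.2 j‖) ≤ Φ 0 := by simp only [Φ] at hw' ⊢; linarith
    have hΦ0 : 0 ≤ Φ 0 := h2.trans h4
    have hY : 0 ≤ ∑ i, |y i| := Finset.sum_nonneg fun i _ => abs_nonneg _
    have hs := Real.sqrt_nonneg (Φ 0 / c)
    have hB : 0 ≤ ∑ i, |y i| + √(Φ 0 / c) + Φ 0 := by positivity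
    have h5 : ∀ j, ‖w.2.1 j‖ + ‖w.2.2 j‖ ≤ Φ 0 := fun j =>
      (Finset.single_le_sum (f := fun j => ‖w.2.1 j‖ + ‖w.2.2 j‖) (fun j _ => by positivity)
        (Finset.mem_univ j)).trans h4
    refine norm_prod_le_iff.2 ⟨(pi_norm_le_iff_of_nonneg hB).2 fun i => ?_,
      norm_prod_le_iff.2 ⟨(pi_norm_le_iff_of_nonneg hB).2 fun j => ?_,
        (pi_norm_le_iff_of_nonneg hB).2 fun j => ?_⟩⟩
    · have h6 : |y i - w.1 i| ≤ √(Φ 0 / c) := by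
        refine Real.abs_le_sqrt ?_
        rw [le_div_iff₀ hc0, mul_comm]
        refine le_trans (mul_le_mul_of_nonneg_left ?_ hc0.le) h3
        exact Finset.single_le_sum (f := fun i => (y i - w.1 i) ^ 2) (fun _ _ => sq_nonneg _)
          (Finset.mem_univ i)
      have h7 := Finset.single_le_sum (f := fun i => |y i|) (fun _ _ => abs_nonneg _)
        (Finset.mem_univ i)
      have h8 : |w.1 i| ≤ |y i| + |y i - w.1 i| := by
        have := abs_sub (y i) (y i - w.1 i)
        rwa [sub_sub_cancel] at this
      rw [Real.norm_eq_abs]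
      linarith
    · linarith [h5 j, norm_nonneg (w.2.2 j)]
    · linarith [h5 j, norm_nonneg (w.2.1 j)]
  have hcl : IsClosed (LinearMap.range S : Set (SplitSpace N p M)) :=
    Submodule.closed_of_finiteDimensional _
  have hcomp : IsCompact ((LinearMap.range S : Set (SplitSpace N p M)) ∩ {w | Φ w ≤ Φ 0}) :=
    Metric.isCompact_of_isClosed_isBounded
      (hcl.inter (isClosed_le hΦc continuous_const)) (hbdd.subset Set.inter_subset_right)
  obtain ⟨w, ⟨⟨b, rfl⟩, hw⟩, hmin⟩ := hcomp.exists_isMinOn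
    ⟨0, Submodule.zero_mem _, le_refl (Φ 0)⟩ hΦc.continuousOn
  refine ⟨b, fun z => ?_⟩
  rw [hFΦ, hFΦ]
  rcases le_total (Φ (S z)) (Φ 0) with h | h
  · exact hmin ⟨⟨z, rfl⟩, h⟩
  · exact le_trans hw h

end Losses

/-! ### Linear convergence for separable losses. -/

section LinearLosses
variable {p M N : ℕ} [NeZero p] [NeZero M] {L : Coef p M → ℝ} {C : Fin p → ℝ} {lam α θ Θ : ℝ}
  {x : ℕ → Coef p M} {t : ℕ → ℝ}

/-- Linear convergence for a sum of nonnegative losses of linear functionals. -/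
theorem IsProxRun.convergesLinearly_of_separable (hx : IsProxRun L lam α θ Θ x t)
    (hlam : 0 ≤ lam) (hα0 : 0 ≤ α) (hα1 : α ≤ 1) (hC : BlockLipschitz L C)
    (hc : ConvexOn ℝ Set.univ L) (hL : Differentiable ℝ L) (hCpos : ∀ j, 0 < C j)
    {l : Fin N → Coef p M →ₗ[ℝ] ℝ} {ψ ψ' : Fin N → ℝ → ℝ}
    (hψ : ∀ i s, HasDerivAt (ψ i) (ψ' i s) s) (hψ0 : ∀ i s, 0 ≤ ψ i s)
    (hgrow : ∀ i, BregmanGrowth (ψ i) (ψ' i)) (hLψ : ∀ β, L β = ∑ i, ψ i (l i β))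
    (hne : (minimizers (splamObj L lam α)).Nonempty) :
    ConvergesLinearly (splamObj L lam α) fun k => x (k * p) := by
  obtain ⟨b, hb⟩ := hne
  obtain ⟨κ, hκ, h⟩ := exists_quadratic_growth hψ hψ0 hgrow hL hLψ hlam hα0 hα1 hC hCpos hb
    (splamObj L lam α (x 0))
  refine hx.convergesLinearly hlam hα0 hα1 hC hc hL hCpos hb hκ one_pos fun y w hy hw _ => ?_
  obtain ⟨z, hz, hyz⟩ := h y hy
  have h1 := splamObj_add_inner_le hc hL hw z
  have h2 := hz b
  have h3 : -inner ℝ (gradient L y + w) (z - y) ≤ ‖gradient L y + w‖ * ‖z - y‖ :=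
    (neg_le_abs _).trans (abs_real_inner_le_norm _ _)
  rw [norm_sub_rev z y] at h3
  set Δ := splamObj L lam α y - splamObj L lam α b with hΔ
  have h4 : Δ ≤ ‖gradient L y + w‖ * ‖y - z‖ := by linarith
  have hΔ0 : 0 ≤ Δ := sub_nonneg.2 (hb y)
  rcases hΔ0.eq_or_lt with h0 | h0
  · rw [← h0]
    positivity
  -- Convexity gives `Δ ≤ ‖v‖ ‖y - z‖` and growth gives `‖y - z‖² ≤ κ Δ`; after squaring, one factor
  -- `Δ` cancels.
  · have h5 : Δ * Δ ≤ κ * ‖gradient L y + w‖ ^ 2 * Δ := by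
      have h6 := pow_le_pow_left₀ h0.le h4 2
      rw [mul_pow] at h6
      have h7 := mul_le_mul_of_nonneg_left hyz (sq_nonneg ‖gradient L y + w‖)
      linarith
    exact le_of_mul_le_mul_right h5 h0

end LinearLosses

/-! ### The main theorem. -/

theorem mainTheorem3 {p M : ℕ} [NeZero p] [NeZero M]
    (L : Coef p M → ℝ) (hLconv : ConvexOn ℝ Set.univ L) (hLdiff : Differentiable ℝ L)
    (C : Fin p → ℝ) (hCpos : ∀ j, 0 < C j)
    (hC : ∀ (j : Fin p) (β : Coef p M) (z z' : EuclideanSpace ℝ (Fin M)),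
      ‖blockGrad L (setBlock β j z) j - blockGrad L (setBlock β j z') j‖ ≤ C j * ‖z - z'‖)
    (lam α : ℝ) (hlam : 0 ≤ lam) (hα0 : 0 ≤ α) (hα1 : α ≤ 1)
    (t0 : Fin p → ℝ) (ht0 : ∀ j, 0 < t0 j)
    (η : ℝ) (hη0 : 0 < η) (hη1 : η < 1)
    (shrink : ℝ → ℝ → ℝ) (hshrink : shrink = max ∨ shrink = min)
    (β0 : Coef p M)
    (F : Coef p M → ℝ) (hF : F = splamObj L lam α)
    (h : Coef p M → ℝ) (hh : h = fun β => lam * splamPenalty α β)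
    (s : ℕ → Coef p M × (Fin p → ℝ)) (hs : s = bcgdState L lam α shrink η C t0 β0)
    (x : ℕ → Coef p M) (hx : x = fun n => (s n).1)
    (t : ℕ → ℝ) (ht : t = fun n => (s (n + 1)).2 (cyclicBlock p n)) :
    -- every backtracking loop stops, and it stops with a step size that is accepted
    ((∀ n, ∃ m, Accepts L lam α (x n) (cyclicBlock p n)
        (backtrackStep shrink η (C (cyclicBlock p n)) ((s n).2 (cyclicBlock p n)) m)) ∧
      (∀ n, Accepts L lam α (x n) (cyclicBlock p n) (t n))) ∧
    -- a trial step with step size `r` is the framework's step with `H = I / r`, and backtracking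
    -- is the Armijo rule with unit step, `σ = 1` and `γ = 1/2`
    (∀ (β : Coef p M) (j : Fin p) (r : ℝ), 0 < r →
      IsCGDDirection L h β j ((1 / r) • ContinuousLinearMap.id ℝ (Coef p M))
        (setBlock β j (trialBlock L lam α β j r) - β) ∧
      (Accepts L lam α β j r ↔
        Armijo L h 1 (1 / 2) β ((1 / r) • ContinuousLinearMap.id ℝ (Coef p M))
          (setBlock β j (trialBlock L lam α β j r) - β) 1)) ∧
    -- bounds on `H n = I / t n`
    (∀ n, min (C (cyclicBlock p n)) (1 / t0 (cyclicBlock p n)) ≤ 1 / t n ∧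
      1 / t n ≤ max (C (cyclicBlock p n) / η) (1 / t0 (cyclicBlock p n)) ∧
      (shrink = max → 1 / t n ≤ max (C (cyclicBlock p n)) (1 / t0 (cyclicBlock p n)))) ∧
    -- the algorithm is a run of the framework, with unit steps, for every `σ` in `(0, 1)`
    (∃ θlo θhi : ℝ, ∀ σ : ℝ, 0 < σ → σ < 1 →
      IsCGDRun L h σ (1 / 2) θlo θhi (cyclicBlock p)
        (fun n => (1 / t n) • ContinuousLinearMap.id ℝ (Coef p M))
        (fun n => x (n + 1) - x n) (fun _ => 1) x) ∧
    -- global convergence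
    ((∀ b : Coef p M, MapClusterPt b atTop x → b ∈ minimizers F) ∧
      (Bornology.IsBounded {β | F β ≤ F β0} →
        ∃ b ∈ minimizers F, Tendsto (fun n => F (x n)) atTop (𝓝 (F b)))) ∧
    -- linear convergence of the iterates `x (k * p)` after `k` full cycles: in general under a
    -- local error bound, and unconditionally for the quadratic and the logistic loss
    ((minimizers F).Nonempty → LocalErrorBound L h →
      ConvergesLinearly F fun k => x (k * p)) ∧
    (∀ (N : ℕ) (X : Matrix (Fin N) (Fin p × Fin M) ℝ) (y : Fin N → ℝ), 0 < N →
      (L = quadLoss X y →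
        ConvergesLinearly F fun k => x (k * p)) ∧
      (L = logisticLoss X y → (∀ i, y i = 1 ∨ y i = -1) → (minimizers F).Nonempty →
        ConvergesLinearly F fun k => x (k * p))) := by
  have hCL : BlockLipschitz L C := hC
  have hpos : ∀ n j, 0 < (s n).2 j := fun n j => by
    rw [hs]
    exact (lt_min (ht0 j) (div_pos hη0 (hCpos j))).trans_le
      (bcgdState_snd_bounds hCL hLdiff hCpos hshrink hη0 hη1 ht0 n j).1
  have htacc : ∀ n, t n = acceptedStep L lam α shrink η C (x n) (cyclicBlock p n)
      ((s n).2 (cyclicBlock p n)) := fun n => by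
    subst hs hx ht
    simp only [bcgdState, Function.update_self]
  have hacc : ∀ n, Accepts L lam α (x n) (cyclicBlock p n) (t n) := fun n => by
    rw [htacc]
    exact accepts_acceptedStep hCL hLdiff hCpos hshrink hη0 hη1 (hpos _ _) lam α _ _
  have hupd : ∀ n, x (n + 1) = setBlock (x n) (cyclicBlock p n)
      (trialBlock L lam α (x n) (cyclicBlock p n) (t n)) := fun n => by
    rw [htacc]
    subst hs hx
    rfl
  have htpos : ∀ n, 0 < t n := fun n => by
    rw [ht]
    exact hpos _ _
  have hbounds : ∀ n, min (C (cyclicBlock p n)) (1 / t0 (cyclicBlock p n)) ≤ 1 / t n ∧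
      1 / t n ≤ max (C (cyclicBlock p n) / η) (1 / t0 (cyclicBlock p n)) ∧
      (shrink = max → 1 / t n ≤ max (C (cyclicBlock p n)) (1 / t0 (cyclicBlock p n))) := by
    intro n
    set j := cyclicBlock p n with hj
    have htj : t n = (bcgdState L lam α shrink η C t0 β0 (n + 1)).2 j := by rw [ht, hs]
    have hb := bcgdState_snd_bounds (lam := lam) (α := α) (β0 := β0) hCL hLdiff hCpos hshrink hη0
      hη1 ht0 (n + 1) j
    rw [← htj] at hb
    refine ⟨?_, ?_, fun hmax => ?_⟩
    · simpa using min_le_one_div_of_le_max (htpos n) hb.2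
    · simpa using one_div_le_max_of_min_le (ht0 j) (div_pos hη0 (hCpos j)) hb.1
    · subst hmax
      have h1 := bcgdState_snd_max_ge (L := L) (lam := lam) (α := α) (C := C) (η := η) (t0 := t0)
        (β0 := β0) (n + 1) j
      rw [← htj] at h1
      simpa using one_div_le_max_of_min_le (ht0 j) (one_div_pos.2 (hCpos j)) h1
  obtain ⟨jlo, hjlo⟩ := Finite.exists_min fun j => min (C j) (1 / t0 j)
  obtain ⟨jhi, hjhi⟩ := Finite.exists_max fun j => max (C j / η) (1 / t0 j)
  set θlo := min (C jlo) (1 / t0 jlo) with hθlo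
  set θhi := max (C jhi / η) (1 / t0 jhi) with hθhi
  have hθ0 : 0 < θlo := lt_min (hCpos _) (one_div_pos.2 (ht0 _))
  have hlo : ∀ n, θlo ≤ 1 / t n := fun n => (hjlo _).trans (hbounds n).1
  have hhi : ∀ n, 1 / t n ≤ θhi := fun n => (hbounds n).2.1.trans (hjhi _)
  have hrun : IsProxRun L lam α θlo θhi x t := ⟨hθ0, htpos, hlo, hhi, hupd, hacc⟩
  have hx0 : x 0 = β0 := by rw [hx, hs]; rfl
  subst hF hh
  refine ⟨⟨fun n => exists_accepts_backtrackStep hCL hLdiff hCpos hshrink hη0 hη1 (hpos _ _) lam α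
      _ _, hacc⟩, fun β j r hr => ⟨trial_isCGDDirection hlam hα0 hα1 L β j hr,
      accepts_iff_armijo L lam α β j r⟩, hbounds, ⟨θlo, θhi, fun σ hσ0 hσ1 => ?_⟩,
    ⟨fun b hb => hrun.mem_minimizers_of_mapClusterPt hlam hα0 hα1 hCL hLconv hLdiff hCpos hb,
      fun hbdd => ?_⟩, fun hne hEB => hrun.convergesLinearly_of_localErrorBound hlam hα0 hα1 hCL
        hLconv hLdiff hCpos hne hEB, fun N X y hN => ⟨fun hLq => ?_, fun hLl hy hne => ?_⟩⟩
  · have hd : ∀ n, x (n + 1) - x n = setBlock (x n) (cyclicBlock p n)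
        (trialBlock L lam α (x n) (cyclicBlock p n) (t n)) - x n := fun n => by rw [hupd n]
    have hdir : ∀ n, IsCGDDirection L (fun β => lam * splamPenalty α β) (x n) (cyclicBlock p n)
        ((1 / t n) • ContinuousLinearMap.id ℝ (Coef p M)) (x (n + 1) - x n) := fun n => by
      rw [hd]
      exact trial_isCGDDirection hlam hα0 hα1 L (x n) (cyclicBlock p n) (htpos n)
    refine
      { sigma_pos := hσ0
        sigma_lt_one := hσ1
        gamma_nonneg := by norm_num
        gamma_lt_one := by norm_num
        theta_pos := hθ0
        theta_le := (hlo 0).trans (hhi 0)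
        symmetric := fun n u v => ?_
        lower := fun n v => ?_
        upper := fun n v => ?_
        direction := hdir
        step_pos := fun _ => one_pos
        armijo := fun n => ?_
        update := fun n => by rw [one_smul, add_sub_cancel] }
    · simp [inner_smul_left, inner_smul_right]
    · rw [inner_smul_id]
      exact mul_le_mul_of_nonneg_right (hlo n) (sq_nonneg _)
    · rw [inner_smul_id]
      exact mul_le_mul_of_nonneg_right (hhi n) (sq_nonneg _)
    · have h1 := (accepts_iff_armijo L lam α _ _ _).1 (hacc n)
      rw [← hd] at h1
      -- Comparing the direction with `0` gives `Δ ≤ 0` for `γ = 1/2`, so the Armijo rule with `σ =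
      -- 1` implies it for every smaller `σ`.
      have h2 := isMinOn_iff.1 (hdir n).2 0 fun i _ => rfl
      simp only [inner_zero_right, inner_zero_left, mul_zero, add_zero, zero_add] at h2
      unfold Armijo cgdDelta at h1 ⊢
      nlinarith
  · rw [← hx0] at hbdd
    exact hrun.exists_minimizer_of_isBounded hlam hα0 hα1 hCL hLconv hLdiff hCpos hbdd
  · subst hLq
    have hc : (0 : ℝ) < 1 / (2 * N) := by
      have : (0 : ℝ) < N := by exact_mod_cast hN
      positivity
    exact hrun.convergesLinearly_of_separable hlam hα0 hα1 hCL hLconv hLdiff hCpos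
      (l := linPredLin X) (fun i s => hasDerivAt_quad _ (y i) s)
      (fun i s => mul_nonneg hc.le (sq_nonneg _)) (fun i => bregmanGrowth_quad hc (y i))
      (fun β => by rw [quadLoss, Finset.mul_sum]; rfl)
      (minimizers_quadLoss_nonempty hlam hα0 hα1 hN X y)
  · subst hLl
    have hc : (0 : ℝ) < 1 / N := by
      have : (0 : ℝ) < N := by exact_mod_cast hN
      positivity
    exact hrun.convergesLinearly_of_separable hlam hα0 hα1 hCL hLconv hLdiff hCpos
      (l := linPredLin X) (fun i s => hasDerivAt_logistic (1 / N) (y i) s)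
      (fun i s => mul_nonneg hc.le (Real.log_nonneg (by linarith [Real.exp_pos (-(y i * s))])))
      (fun i => bregmanGrowth_logistic hc (by rcases hy i with h | h <;> rw [h] <;> norm_num))
      (fun β => by rw [logisticLoss, Finset.mul_sum]; rfl) hne

end
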